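/- Let $(\mathcal A,\varphi)$ be a $W^*$-probability space with $\varphi$ a faithful trace: $\mathcal A$ is a $W^*$-algebra with unit $I$, and $\varphi:\mathcal A\to\mathbb C$ is a normal faithful trace-state. Let $L^2(\mathcal A,\varphi)$ be the completion of $\mathcal A$ in the norm $\|a\|_2=\varphi(a^*a)^{1/2}$. A finite family $(a_i)_{i\in J}$ in $\mathcal A$ is selfadjoint if there is an involution $\sigma$ of $J$ with $a_i^*=a_{\sigma(i)}$ for all $i\in J$. A conjugate system for such a family is a family $(\xi_i)_{i\in J}$ of vectors in the $\|\cdot\|_2$-closure of the unital algebra generated by $\{a_j\}_{j\in J}$ such that, for all $n\ge 0$ and all $i,i_1,\dots,i_n\in J$, $$\varphi(\xi_i a_{i_1}\cdots a_{i_n})=\sum_{m=1}^n\delta_{i,i_m}\,\varphi(a_{i_1}\cdots a_{i_{m-1}})\,\varphi(a_{i_{m+1}}\cdots a_{i_n}).$$ It is unique if it exists. The free Fisher information is $\Phi^*(\{a_i\}_{i\in J})=\sum_{i\in J}\|\xi_i\|_2^2$ if a conjugate system exists, and $\Phi^*(\{a_i\}_{i\in J})=\infty$ otherwise. For a positive integer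 $d$, equip $M_d(\mathcal A)$ with the faithful trace-state $\varphi_d(X)=\frac1d\sum_{i=1}^d\varphi(x_{ii})$; free Fisher information and freeness of elements or subsets of $M_d(\mathcal A)$ are taken with respect to $\varphi_d$. Here subsets $S_1,S_2$ of $M_d(\mathcal A)$ are free if $\varphi_d(x_1\cdots x_n)=0$ whenever $n\ge1$, each $x_k$ lies in the unital algebra generated by $S_{i_k}$, $\varphi_d(x_k)=0$ for all $k$, and $i_k\ne i_{k+1}$ for $1\le k<n$. Then the following hold. 1. For every matrix $A=(a_{ij})_{i,j=1}^d\in M_d(\mathcal A)$, $$\Phi^*(\{a_{ij},a_{ij}^*\}_{1\le i,j\le d})\ \ge\ d^3\,\Phi^*(A,A^*),$$ where the left-hand side refers to the family of $2d^2$ indexed elements $a_{ij},a_{ij}^*$ and the right-hand side to the family of two indexed elements $A,A^*$. Equality holds if $\{A,A^*\}$ is free from the algebra of scalar matrices $M_d(\mathbb C I)\subseteq M_d(\mathcal A)$. 2. For every selfadjoint matrix $B=(b_{ij})_{i,j=1}^d\in M_d(\mathcal A)$, $$\Phi^*(\{b_{ij}\}_{1\le i,j\le d})\ \ge\ d^3\,\Phi^*(B).$$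 Equality holds if $B$ is free from $M_d(\mathbb C I)\subseteq M_d(\mathcal A)$. -/

import Mathlib

open scoped ComplexOrder ENNReal

/-- `φ` is a normal faithful trace-state.  A `WStarAlgebra` together with such a `φ` is a
`W*`-probability space whose state is a faithful trace. -/
structure IsFaithfulNormalTracialState {M : Type*} [CStarAlgebra M] [PartialOrder M]
    [StarOrderedRing M] (φ : M →ₚ[ℂ] ℂ) : Prop where
  map_one : φ 1 = 1
  map_mul_comm : ∀ x y : M, φ (x * y) = φ (y * x)
  faithful : ∀ x : M, φ (star x * x) = 0 → x = 0
  /-- Normality: `φ` preserves suprema of bounded increasing nets of positive elements. -/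
  normal : ∀ (D : Set M) (s : M), D.Nonempty → DirectedOn (· ≤ ·) D → (∀ x ∈ D, 0 ≤ x) →
    IsLUB D s → IsLUB ((fun x => (φ x).re) '' D) (φ s).re

namespace FreeProb

noncomputable section

variable {M : Type*} [CStarAlgebra M] [PartialOrder M] [StarOrderedRing M]

/-- The canonical map of `M` into `L²(M, φ)`, the completion of `M` with respect to
`‖x‖₂ = √(φ (x* x))`. -/
def toL2 (φ : M →ₚ[ℂ] ℂ) (x : M) : φ.GNS := ((φ.toPreGNS x : φ.PreGNS) : φ.GNS)

/-- The number `φ (ξ x)` for `ξ ∈ L²(M, φ)` and `x ∈ M`, for a trace `φ`: it is continuous in `ξ`,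
and for `ξ = y ∈ M` it is `φ (y x) = φ (x y) = ⟪x*, y⟫`. -/
def expect (φ : M →ₚ[ℂ] ℂ) (ξ : φ.GNS) (x : M) : ℂ := inner ℂ (toL2 φ (star x)) ξ

/-- On vectors `ξ = y ∈ M`, `expect` is the expectation of the product. -/
theorem expect_toL2 (φ : M →ₚ[ℂ] ℂ) (hφ : ∀ x y : M, φ (x * y) = φ (y * x)) (x y : M) :
    expect φ (toL2 φ y) x = φ (y * x) := by
  rw [expect, toL2, toL2, UniformSpace.Completion.inner_coe, φ.preGNS_inner_def, hφ y x]
  simp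

/-- `monomial a b₀ [(i₁, b₁), …, (iₙ, bₙ)] = b₀ a_{i₁} b₁ ⋯ a_{iₙ} bₙ`. -/
def monomial {I : Type*} (a : I → M) (b₀ : M) (w : List (I × M)) : M :=
  b₀ * (w.map fun p => a p.1 * p.2).prod

open Classical in
/-- The conjugate relations for the family `a`, with respect to `B`: for all `i, i₁, …, iₙ` and
all `b₀, …, bₙ ∈ B`, where `n ≥ 0`,
`φ (ξᵢ b₀ a_{i₁} b₁ ⋯ a_{iₙ} bₙ) =
  ∑ₘ δ_{i, iₘ} φ (b₀ a_{i₁} ⋯ a_{iₘ₋₁} bₘ₋₁) φ (bₘ a_{iₘ₊₁} ⋯ a_{iₙ} bₙ)`. -/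
def ConjugateRelations {I : Type*} (φ : M →ₚ[ℂ] ℂ) (a : I → M) (B : StarSubalgebra ℂ M)
    (ξ : I → φ.GNS) : Prop :=
  ∀ (i : I) (b₀ : M) (w : List (I × M)), b₀ ∈ B → (∀ p ∈ w, p.2 ∈ B) →
    expect φ (ξ i) (monomial a b₀ w) =
      ∑ m : Fin w.length, if i = w[m].1 then
        φ (monomial a b₀ (w.take m)) * φ (monomial a w[m].2 (w.drop (m + 1))) else 0

/-- `ξ` is a conjugate system for `a` with respect to `B`: it satisfies the conjugate relations,
and its vectors lie in the `‖·‖₂`-closure of the algebra generated by `a` and `B`. -/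
structure IsConjugateSystem {I : Type*} (φ : M →ₚ[ℂ] ℂ) (a : I → M) (B : StarSubalgebra ℂ M)
    (ξ : I → φ.GNS) : Prop where
  relations : ConjugateRelations φ a B ξ
  mem_closure : ∀ i, ξ i ∈
    closure (toL2 φ '' (Algebra.adjoin ℂ (Set.range a ∪ (B : Set M)) : Set M))

open Classical in
/-- The free Fisher information `Φ*({aᵢ} : B) = ∑ᵢ ‖ξᵢ‖²` of a selfadjoint family `a` (one with
`aᵢ* = a_{σ i}` for an involution `σ` of `I`) with respect to `B`, where `ξ` is the conjugate
system, which is unique for such families; it is `∞` if there is no conjugate system. -/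
def fisherRel {I : Type*} [Fintype I] (φ : M →ₚ[ℂ] ℂ) (a : I → M) (B : StarSubalgebra ℂ M) :
    ℝ≥0∞ :=
  if h : ∃ ξ : I → φ.GNS, IsConjugateSystem φ a B ξ then
    ∑ i, ENNReal.ofReal (‖h.choose i‖ ^ 2)
  else ⊤

/-- The free Fisher information `Φ*({aᵢ}) = Φ*({aᵢ} : ℂ1)`. -/
def fisher {I : Type*} [Fintype I] (φ : M →ₚ[ℂ] ℂ) (a : I → M) : ℝ≥0∞ :=
  fisherRel φ a ⊥

/-- Freeness of a family of subsets of `M`: whenever `x₀, …, xₙ` are centred, `x_k` lies in the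
unital algebra generated by the `i_k`-th subset, and neighbouring indices are distinct, the product
`x₀ ⋯ xₙ` is centred. -/
def IsFree {ι : Type*} (φ : M →ₚ[ℂ] ℂ) (S : ι → Set M) : Prop :=
  ∀ (n : ℕ) (i : Fin (n + 1) → ι) (x : Fin (n + 1) → M),
    (∀ k, x k ∈ Algebra.adjoin ℂ (S (i k))) → (∀ k, φ (x k) = 0) →
    (∀ k : Fin n, i k.castSucc ≠ i k.succ) → φ (List.ofFn x).prod = 0

/-- The state `φ_d = tr ⊗ φ` on `M_d(M)`, that is `φ_d(X) = (1 / d) ∑ᵢ φ(Xᵢᵢ)`. -/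
def matrixState (φ : M →ₚ[ℂ] ℂ) (d : ℕ) : CStarMatrix (Fin d) (Fin d) M →ₚ[ℂ] ℂ :=
  PositiveLinearMap.mk₀
    { toFun := fun X => (d : ℂ)⁻¹ * ∑ i, φ (X i i)
      map_add' := fun X Y => by simp [Finset.sum_add_distrib, mul_add]
      map_smul' := fun c X => by
        simp only [CStarMatrix.smul_apply, map_smul, smul_eq_mul, ← Finset.mul_sum,
          RingHom.id_apply]
        ring }
    (fun X hX => by
      rw [StarOrderedRing.nonneg_iff] at hX
      induction hX using AddSubmonoid.closure_induction with
      | mem X h =>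
        obtain ⟨Y, rfl⟩ := h
        refine mul_nonneg (by simp) (Finset.sum_nonneg fun i _ => φ.map_nonneg ?_)
        change 0 ≤ (star Y * Y) i i
        rw [CStarMatrix.mul_apply]
        exact Finset.sum_nonneg fun j _ => star_mul_self_nonneg (Y j i)
      | zero => simp
      | add X Y _ _ hX hY => rw [map_add]; exact add_nonneg hX hY)

theorem matrixState_apply (φ : M →ₚ[ℂ] ℂ) (d : ℕ) (X : CStarMatrix (Fin d) (Fin d) M) :
    matrixState φ d X = (d : ℂ)⁻¹ * ∑ i, φ (X i i) := rfl

variable (M) in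
/-- The scalar matrices `M_d(ℂ1) ⊆ M_d(M)`. -/
def scalarMatrices (d : ℕ) : Set (CStarMatrix (Fin d) (Fin d) M) :=
  {X | ∀ i j, ∃ c : ℂ, X i j = algebraMap ℂ M c}

end

end FreeProb

open FreeProb

/-! The conjugate relations say that `φ (ξᵢ P(a)) = (φ ⊗ φ)(∂ᵢ P)` for every noncommutative
polynomial `P`, where `∂ᵢ` is the free difference quotient. A vector satisfying them can be
projected onto the `L²`-closure of the algebra generated by the family. The relations survive and
the norm does not grow, so any solution bounds the Fisher information from above (`fisher_le_sum`).

Inequality: removing `x_{pq}` from the `(r, s)` entry of `P(A)` leaves an `(r, p)` entry tensor a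
`(q, s)` entry of the matrix-level `∂P` (`freeDiff_genericMatrix`). Hence, if `ξ` is conjugate to
the entries, the matrix with `(i, j)` entry `d⁻¹ ξ_{ji}` solves the relations for `A`. Its squared
norm is `d⁻¹ · d⁻² ∑ ‖ξ_{ij}‖²`, which accounts for `d³`.

Equality: if `A` is free from the matrix units, its conjugate relations extend to polynomials in `A`
and the matrix units, with `∂` killing the latter (`expect_eq_of_isFree`). Since `x_{pq} I = ∑ᵣ
e_{rp} A e_{qr}`, each `P(a) ⊗ e_{pq}` is such a polynomial, and testing against it shows that `d`
times the transposed entries of the conjugate vector of `A` are conjugate to the entries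
(`isConjugateSystem_entries`). -/

namespace FreeProb

noncomputable section

open scoped TensorProduct

/-! ### Difference quotients of noncommutative polynomials and the conjugate relations -/

section

section Derivation

variable {M : Type*} [Ring M] [Algebra ℂ M] {J : Type*}

/-- The homomorphism `P ↦ [[P(a) ⊗ 1, ∂P], [0, 1 ⊗ P(a)]]`, where `∂` is the derivation with
`∂ Xⱼ = δ j`. -/
def derHom (a : J → M) (δ : J → M ⊗[ℂ] M) :
    FreeAlgebra ℂ J →ₐ[ℂ] Matrix (Fin 2) (Fin 2) (M ⊗[ℂ] M) :=
  FreeAlgebra.lift ℂ fun j => !![a j ⊗ₜ 1, δ j; 0, 1 ⊗ₜ a j]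

/-- The derivation of noncommutative polynomials, evaluated at `a`, that maps `Xⱼ` to `δ j`. -/
def der (a : J → M) (δ : J → M ⊗[ℂ] M) : FreeAlgebra ℂ J →ₗ[ℂ] M ⊗[ℂ] M :=
  Matrix.entryLinearMap ℂ (M ⊗[ℂ] M) 0 1 ∘ₗ (derHom a δ).toLinearMap

variable (a : J → M) (δ : J → M ⊗[ℂ] M)

theorem der_apply (P : FreeAlgebra ℂ J) : der a δ P = derHom a δ P 0 1 := rfl

/-- Products of upper triangular matrices multiply the diagonals, and the corner of a product is
then exactly the Leibniz rule `der_mul`. -/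
theorem derHom_entries (P : FreeAlgebra ℂ J) :
    derHom a δ P 0 0 = FreeAlgebra.lift ℂ a P ⊗ₜ 1 ∧ derHom a δ P 1 0 = 0 ∧
      derHom a δ P 1 1 = 1 ⊗ₜ FreeAlgebra.lift ℂ a P := by
  induction P using FreeAlgebra.induction with
  | grade0 r =>
    rw [AlgHom.commutes, AlgHom.commutes]
    refine ⟨?_, ?_, ?_⟩
    · simp [Matrix.algebraMap_matrix_apply, Algebra.TensorProduct.algebraMap_apply]
    · simp [Matrix.algebraMap_matrix_apply]
    · rw [Matrix.algebraMap_matrix_apply, if_pos rfl, Algebra.TensorProduct.algebraMap_apply,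
        Algebra.algebraMap_eq_smul_one, TensorProduct.smul_tmul]
  | grade1 j => simp [derHom]
  | mul P Q hP hQ =>
    simp only [map_mul, Matrix.mul_apply, Fin.sum_univ_two, hP, hQ]
    simp
  | add P Q hP hQ =>
    simp only [map_add, Matrix.add_apply, hP, hQ]
    simp [TensorProduct.add_tmul, TensorProduct.tmul_add]

@[simp]
theorem der_ι (j : J) : der a δ (FreeAlgebra.ι ℂ j) = δ j := by
  simp [der_apply, derHom]

@[simp]
theorem der_algebraMap (r : ℂ) : der a δ (algebraMap ℂ _ r) = 0 := by
  simp [der_apply, Matrix.algebraMap_matrix_apply]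

@[simp]
theorem der_one : der a δ 1 = 0 := by
  simp [der_apply]

theorem der_mul (P Q : FreeAlgebra ℂ J) :
    der a δ (P * Q) = (FreeAlgebra.lift ℂ a P ⊗ₜ 1) * der a δ Q +
      der a δ P * (1 ⊗ₜ FreeAlgebra.lift ℂ a Q) := by
  simp only [der_apply, map_mul, Matrix.mul_apply, Fin.sum_univ_two, derHom_entries]

theorem freeAlgebra_span_lists :
    Submodule.span ℂ (Set.range fun l : List J => (l.map (FreeAlgebra.ι ℂ)).prod) = ⊤ := by
  rw [← Algebra.top_toSubmodule, ← FreeAlgebra.adjoin_range_ι, Algebra.adjoin_eq_span]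
  congr 1
  ext x
  constructor
  · rintro ⟨l, rfl⟩
    refine Submonoid.list_prod_mem _ fun y hy => Submonoid.subset_closure ?_
    obtain ⟨j, -, rfl⟩ := List.mem_map.1 hy
    exact ⟨j, rfl⟩
  · intro hx
    induction hx using Submonoid.closure_induction with
    | mem x hx => obtain ⟨j, rfl⟩ := hx; exact ⟨[j], by simp⟩
    | one => exact ⟨[], rfl⟩
    | mul x y _ _ hx hy =>
      obtain ⟨l, rfl⟩ := hx
      obtain ⟨m, rfl⟩ := hy
      exact ⟨l ++ m, by simp⟩

end Derivation

variable {M : Type*} [CStarAlgebra M]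

/-- The free difference quotient with respect to the `i`-th variable, evaluated at `a`. -/
def freeDiff {I : Type*} [DecidableEq I] (a : I → M) (i : I) : FreeAlgebra ℂ I →ₗ[ℂ] M ⊗[ℂ] M :=
  der a fun j => if i = j then 1 else 0

theorem freeDiff_mul {I : Type*} [DecidableEq I] (a : I → M) (i : I) (P Q : FreeAlgebra ℂ I) :
    freeDiff a i (P * Q) = (FreeAlgebra.lift ℂ a P ⊗ₜ 1) * freeDiff a i Q +
      freeDiff a i P * (1 ⊗ₜ FreeAlgebra.lift ℂ a Q) := der_mul _ _ _ _

section Monomial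

variable {I : Type*} (a : I → M)

@[simp]
theorem monomial_nil (c : M) : monomial a c [] = c := by simp [monomial]

theorem monomial_cons (c : M) (p : I × M) (w : List (I × M)) :
    monomial a c (p :: w) = monomial a (c * a p.1 * p.2) w := by
  simp [monomial, mul_assoc]

theorem mul_monomial (b c : M) (w : List (I × M)) :
    b * monomial a c w = monomial a (b * c) w := by
  simp [monomial, mul_assoc]

/-- The sum of the splittings of the word `c a_{i₁} b₁ ⋯ a_{iₙ} bₙ` at the letters `aᵢ`. -/
def splitSum [DecidableEq I] (i : I) (c : M) (w : List (I × M)) : M ⊗[ℂ] M :=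
  ∑ m : Fin w.length, if i = w[m].1 then
    monomial a c (w.take m) ⊗ₜ[ℂ] monomial a w[m].2 (w.drop (m + 1)) else 0

theorem splitSum_nil [DecidableEq I] (i : I) (c : M) : splitSum a i c [] = 0 := by
  rw [splitSum]
  exact Finset.sum_empty

theorem splitSum_cons [DecidableEq I] (i : I) (c : M) (p : I × M) (w : List (I × M)) :
    splitSum a i c (p :: w) =
      (if i = p.1 then c ⊗ₜ[ℂ] monomial a p.2 w else 0) + splitSum a i (c * a p.1 * p.2) w := by
  simp only [splitSum, List.length_cons]
  rw [Fin.sum_univ_succ]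
  simp [monomial_cons]

/-- The noncommutative polynomial `Q X_{i₁} c₁ ⋯ X_{iₙ} cₙ`. -/
def freeMonomial (Q : FreeAlgebra ℂ I) : List (I × ℂ) → FreeAlgebra ℂ I
  | [] => Q
  | p :: w => freeMonomial (Q * FreeAlgebra.ι ℂ p.1 * algebraMap ℂ _ p.2) w

variable (M) in
/-- The word with coefficients in `M` defined by a word with scalar coefficients. -/
def scalarWord (w : List (I × ℂ)) : List (I × M) := w.map fun p => (p.1, algebraMap ℂ M p.2)

theorem scalarWord_nil : scalarWord M ([] : List (I × ℂ)) = [] := rfl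

theorem scalarWord_cons (p : I × ℂ) (w : List (I × ℂ)) :
    scalarWord M (p :: w) = (p.1, algebraMap ℂ M p.2) :: scalarWord M w := rfl

theorem lift_freeMonomial (Q : FreeAlgebra ℂ I) (w : List (I × ℂ)) :
    FreeAlgebra.lift ℂ a (freeMonomial Q w) =
      monomial a (FreeAlgebra.lift ℂ a Q) (scalarWord M w) := by
  induction w generalizing Q with
  | nil => simp [freeMonomial, scalarWord_nil]
  | cons p w ih =>
    rw [freeMonomial, ih, scalarWord_cons, monomial_cons]
    simp

/-- The head `Q` stays arbitrary because the induction absorbs the letters into it one by one; the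
Leibniz rule produces one splitting for each absorbed `Xᵢ`. -/
theorem freeDiff_freeMonomial [DecidableEq I] (i : I) (Q : FreeAlgebra ℂ I) (w : List (I × ℂ)) :
    freeDiff a i (freeMonomial Q w) =
      freeDiff a i Q * (1 ⊗ₜ monomial a 1 (scalarWord M w)) +
        splitSum a i (FreeAlgebra.lift ℂ a Q) (scalarWord M w) := by
  induction w generalizing Q with
  | nil => simp [freeMonomial, scalarWord_nil, splitSum_nil, ← Algebra.TensorProduct.one_def]
  | cons p w ih =>
    rw [freeMonomial, ih, scalarWord_cons, splitSum_cons, ← add_assoc]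
    congr 1
    · simp only [freeDiff, der_mul, der_ι, der_algebraMap, AlgHom.commutes,
        FreeAlgebra.lift_ι_apply, map_mul, monomial_cons, mul_zero, zero_add, add_mul, mul_assoc,
        Algebra.TensorProduct.tmul_mul_tmul, mul_one, one_mul, mul_monomial]
      rw [add_comm]
      split_ifs with h <;> simp [mul_monomial]
    · simp

end Monomial

theorem scalarWord_one_freeMonomial {I : Type*} (Q : FreeAlgebra ℂ I) (l : List I) :
    freeMonomial Q (l.map fun j => (j, 1)) = Q * (l.map (FreeAlgebra.ι ℂ)).prod := by
  induction l generalizing Q with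
  | nil => simp [freeMonomial]
  | cons j l ih => simp [freeMonomial, ih, mul_assoc]

theorem exists_scalarWord {I : Type*} (w : List (I × M))
    (hw : ∀ p ∈ w, p.2 ∈ (⊥ : StarSubalgebra ℂ M)) : ∃ v, w = scalarWord M v := by
  induction w with
  | nil => exact ⟨[], rfl⟩
  | cons p w ih =>
    obtain ⟨v, hv⟩ := ih fun q hq => hw q (List.mem_cons_of_mem _ hq)
    obtain ⟨c, hc⟩ := StarSubalgebra.mem_bot.1 (hw p List.mem_cons_self)
    exact ⟨(p.1, c) :: v, by rw [hv]; simp [scalarWord_cons, hc]⟩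

variable [PartialOrder M]

/-- The functional `φ ⊗ φ` on `M ⊗ M`. -/
def tensorState (φ : M →ₚ[ℂ] ℂ) : M ⊗[ℂ] M →ₗ[ℂ] ℂ :=
  LinearMap.mul' ℂ ℂ ∘ₗ TensorProduct.map φ.toLinearMap φ.toLinearMap

@[simp]
theorem tensorState_tmul (φ : M →ₚ[ℂ] ℂ) (x y : M) : tensorState φ (x ⊗ₜ y) = φ x * φ y := by
  simp [tensorState]

variable [StarOrderedRing M]

/-- `x ↦ φ (ξ x)` as a linear functional. -/
def expectₗ (φ : M →ₚ[ℂ] ℂ) (ξ : φ.GNS) : M →ₗ[ℂ] ℂ where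
  toFun x := expect φ ξ x
  map_add' x y := by
    simp [expect, toL2, UniformSpace.Completion.coe_add, inner_add_left]
  map_smul' c x := by
    simp [expect, toL2, UniformSpace.Completion.coe_smul, inner_smul_left]

@[simp]
theorem expectₗ_apply (φ : M →ₚ[ℂ] ℂ) (ξ : φ.GNS) (x : M) : expectₗ φ ξ x = expect φ ξ x := rfl

/-- Both sides are linear in `P` and words with coefficients `1` span the polynomials. Conversely,
coefficients in `⊥` are scalars, so every weighted word is the value of a polynomial. -/
theorem conjugateRelations_bot_iff {I : Type*} [DecidableEq I] (φ : M →ₚ[ℂ] ℂ) (a : I → M)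
    (ξ : I → φ.GNS) :
    ConjugateRelations φ a ⊥ ξ ↔ ∀ i P,
      expect φ (ξ i) (FreeAlgebra.lift ℂ a P) = tensorState φ (freeDiff a i P) := by
  constructor
  · intro h i P
    suffices (expectₗ φ (ξ i)) ∘ₗ (FreeAlgebra.lift ℂ a).toLinearMap =
        tensorState φ ∘ₗ freeDiff a i from LinearMap.congr_fun this P
    refine LinearMap.ext_on_range (freeAlgebra_span_lists (J := I)) fun l => ?_
    have := h i 1 (scalarWord M (l.map fun j => (j, 1))) (one_mem _) (by
      intro p hp
      obtain ⟨q, -, rfl⟩ := List.mem_map.1 hp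
      exact StarSubalgebra.algebraMap_mem _ _)
    rw [LinearMap.comp_apply, LinearMap.comp_apply, ← one_mul (List.prod _),
      ← scalarWord_one_freeMonomial, freeDiff_freeMonomial, AlgHom.toLinearMap_apply,
      lift_freeMonomial, expectₗ_apply, map_one, this]
    simp only [freeDiff, der_one, zero_mul, zero_add, splitSum, map_sum]
    refine Finset.sum_congr rfl fun m _ => ?_
    split_ifs <;> simp
  · intro h i b w hb hw
    obtain ⟨c, rfl⟩ := StarSubalgebra.mem_bot.1 hb
    obtain ⟨v, rfl⟩ := exists_scalarWord w hw
    have := h i (freeMonomial (algebraMap ℂ _ c) v)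
    rw [lift_freeMonomial, freeDiff_freeMonomial, AlgHom.commutes] at this
    rw [this]
    simp only [freeDiff, der_algebraMap, zero_mul, zero_add, splitSum, map_sum]
    refine Finset.sum_congr rfl fun m _ => ?_
    split_ifs <;> simp

end

/-! ### Uniqueness, minimality and reindexing of conjugate systems -/

section

variable {M : Type*} [CStarAlgebra M] {I : Type*}

theorem adjoin_union_bot (s : Set M) :
    Algebra.adjoin ℂ (s ∪ ((⊥ : StarSubalgebra ℂ M) : Set M)) = Algebra.adjoin ℂ s := by
  refine le_antisymm (Algebra.adjoin_le ?_) (Algebra.adjoin_mono Set.subset_union_left)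
  rintro x (hx | hx)
  · exact Algebra.subset_adjoin hx
  · obtain ⟨c, rfl⟩ := StarSubalgebra.mem_bot.1 hx
    exact Subalgebra.algebraMap_mem _ c

theorem star_mem_adjoin {a : I → M} (ha : ∀ i, ∃ j, star (a i) = a j) {x : M}
    (hx : x ∈ Algebra.adjoin ℂ (Set.range a)) : star x ∈ Algebra.adjoin ℂ (Set.range a) := by
  induction hx using Algebra.adjoin_induction with
  | mem x hx =>
    obtain ⟨i, rfl⟩ := hx
    obtain ⟨j, hj⟩ := ha i
    exact Algebra.subset_adjoin ⟨j, hj.symm⟩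
  | algebraMap r =>
    rw [← algebraMap_star_comm]
    exact Subalgebra.algebraMap_mem _ _
  | add x y _ _ hx hy => rw [star_add]; exact add_mem hx hy
  | mul x y _ _ hx hy => rw [star_mul]; exact mul_mem hy hx

theorem lift_mem_adjoin (a : I → M) (P : FreeAlgebra ℂ I) :
    FreeAlgebra.lift ℂ a P ∈ Algebra.adjoin ℂ (Set.range a) := by
  rw [Algebra.adjoin_range_eq_range_freeAlgebra_lift]
  exact ⟨P, rfl⟩

theorem lift_map_equiv {J : Type*} (a : I → M) (e : J ≃ I) (P : FreeAlgebra ℂ J) :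
    FreeAlgebra.lift ℂ a (FreeAlgebra.lift ℂ (FreeAlgebra.ι ℂ ∘ e) P) =
      FreeAlgebra.lift ℂ (a ∘ e) P := by
  rw [← AlgHom.comp_apply]
  congr 1
  ext j
  simp

theorem freeDiff_map_equiv {J : Type*} [DecidableEq I] [DecidableEq J] (a : I → M) (e : J ≃ I)
    (j : J) (P : FreeAlgebra ℂ J) :
    freeDiff a (e j) (FreeAlgebra.lift ℂ (FreeAlgebra.ι ℂ ∘ e) P) = freeDiff (a ∘ e) j P := by
  induction P using FreeAlgebra.induction with
  | grade0 r => simp [freeDiff]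
  | grade1 k => simp [freeDiff]
  | mul P Q hP hQ =>
    simp only [freeDiff, map_mul, der_mul, lift_map_equiv] at hP hQ ⊢
    rw [hP, hQ]
  | add P Q hP hQ => simp only [map_add, hP, hQ]

variable [PartialOrder M] [StarOrderedRing M]

/-- The canonical map of `M` into `L²(M, φ)` as a linear map. -/
def toL2ₗ (φ : M →ₚ[ℂ] ℂ) : M →ₗ[ℂ] φ.GNS where
  toFun := toL2 φ
  map_add' x y := by simp [toL2, UniformSpace.Completion.coe_add]
  map_smul' c x := by simp [toL2, UniformSpace.Completion.coe_smul]

@[simp]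
theorem toL2ₗ_apply (φ : M →ₚ[ℂ] ℂ) (x : M) : toL2ₗ φ x = toL2 φ x := rfl

theorem denseRange_toL2ₗ (φ : M →ₚ[ℂ] ℂ) : DenseRange (toL2ₗ φ) :=
  (UniformSpace.Completion.denseRange_coe (α := φ.PreGNS)).comp
    φ.toPreGNS.surjective.denseRange (UniformSpace.Completion.continuous_coe _)

theorem inner_toL2 (φ : M →ₚ[ℂ] ℂ) (x y : M) :
    inner ℂ (toL2 φ x) (toL2 φ y) = φ (star x * y) := by
  rw [toL2, toL2, UniformSpace.Completion.inner_coe, φ.preGNS_inner_def]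
  simp

/-- The closure in `L²(M, φ)` of the algebra generated by the family `a`. -/
def l2Closure (φ : M →ₚ[ℂ] ℂ) (a : I → M) : Submodule ℂ φ.GNS :=
  ((Subalgebra.toSubmodule (Algebra.adjoin ℂ (Set.range a))).map (toL2ₗ φ)).topologicalClosure

instance (φ : M →ₚ[ℂ] ℂ) (a : I → M) : CompleteSpace (l2Closure φ a) :=
  (Submodule.isClosed_topologicalClosure _).completeSpace_coe

theorem toL2_mem_l2Closure (φ : M →ₚ[ℂ] ℂ) (a : I → M) {x : M}
    (hx : x ∈ Algebra.adjoin ℂ (Set.range a)) : toL2 φ x ∈ l2Closure φ a :=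
  Submodule.le_topologicalClosure _ ⟨x, hx, rfl⟩

theorem coe_l2Closure (φ : M →ₚ[ℂ] ℂ) (a : I → M) :
    (l2Closure φ a : Set φ.GNS) =
      closure (toL2 φ '' (Algebra.adjoin ℂ (Set.range a) : Set M)) := rfl

theorem isConjugateSystem_bot_iff [DecidableEq I] (φ : M →ₚ[ℂ] ℂ) (a : I → M) (ξ : I → φ.GNS) :
    IsConjugateSystem φ a ⊥ ξ ↔
      (∀ i P, expect φ (ξ i) (FreeAlgebra.lift ℂ a P) = tensorState φ (freeDiff a i P)) ∧
        ∀ i, ξ i ∈ l2Closure φ a := by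
  rw [← conjugateRelations_bot_iff]
  constructor
  · rintro ⟨h, h'⟩
    refine ⟨h, fun i => ?_⟩
    have := h' i
    rwa [adjoin_union_bot, ← coe_l2Closure] at this
  · rintro ⟨h, h'⟩
    refine ⟨h, fun i => ?_⟩
    rw [adjoin_union_bot, ← coe_l2Closure]
    exact h' i

/-- Vectors in the `L²`-closure of a selfadjoint algebra are determined by `expect`. -/
theorem eq_of_expect_eq (φ : M →ₚ[ℂ] ℂ) {a : I → M} (ha : ∀ i, ∃ j, star (a i) = a j)
    {ξ η : φ.GNS} (hξ : ξ ∈ l2Closure φ a) (hη : η ∈ l2Closure φ a)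
    (h : ∀ P, expect φ ξ (FreeAlgebra.lift ℂ a P) = expect φ η (FreeAlgebra.lift ℂ a P)) :
    ξ = η := by
  -- The inner product with `x` is the expectation against `star x`, which is again a polynomial in
  -- the selfadjoint family. So the difference is orthogonal to the closure that contains it.
  have hmem : ξ - η ∈ (l2Closure φ a)ᗮ := by
    rw [l2Closure, Submodule.orthogonal_closure, Submodule.mem_orthogonal]
    rintro _ ⟨x, hx, rfl⟩
    have hx' := star_mem_adjoin ha hx
    rw [Algebra.adjoin_range_eq_range_freeAlgebra_lift] at hx'
    obtain ⟨P, hP⟩ := hx'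
    have := h P
    simp only [expect] at this
    erw [hP, star_star] at this
    rw [inner_sub_right, toL2ₗ_apply, this, sub_self]
  have := (Submodule.mem_orthogonal _ _).1 hmem _ (sub_mem hξ hη)
  exact sub_eq_zero.1 (inner_self_eq_zero.1 this)

theorem IsConjugateSystem.unique {φ : M →ₚ[ℂ] ℂ} {a : I → M}
    (ha : ∀ i, ∃ j, star (a i) = a j) {ξ η : I → φ.GNS}
    (hξ : IsConjugateSystem φ a ⊥ ξ) (hη : IsConjugateSystem φ a ⊥ η) : ξ = η := by
  classical
  rw [isConjugateSystem_bot_iff] at hξ hη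
  funext i
  exact eq_of_expect_eq φ ha (hξ.2 i) (hη.2 i) fun P => by rw [hξ.1, hη.1]

/-- Uniqueness makes the choice in `fisherRel` immaterial. -/
theorem fisher_eq_sum [Fintype I] {φ : M →ₚ[ℂ] ℂ} {a : I → M}
    (ha : ∀ i, ∃ j, star (a i) = a j) {ξ : I → φ.GNS} (hξ : IsConjugateSystem φ a ⊥ ξ) :
    fisher φ a = ∑ i, ENNReal.ofReal (‖ξ i‖ ^ 2) := by
  have h : ∃ ξ : I → φ.GNS, IsConjugateSystem φ a ⊥ ξ := ⟨ξ, hξ⟩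
  rw [fisher, fisherRel, dif_pos h, h.choose_spec.unique ha hξ]

theorem fisher_eq_top [Fintype I] {φ : M →ₚ[ℂ] ℂ} {a : I → M}
    (h : ¬∃ ξ : I → φ.GNS, IsConjugateSystem φ a ⊥ ξ) : fisher φ a = ⊤ := by
  rw [fisher, fisherRel, dif_neg h]

/-- A solution of the conjugate relations yields a conjugate system of smaller norm. -/
theorem fisher_le_sum [Fintype I] [DecidableEq I] {φ : M →ₚ[ℂ] ℂ} {a : I → M}
    (ha : ∀ i, ∃ j, star (a i) = a j) {ξ : I → φ.GNS}
    (hξ : ∀ i P, expect φ (ξ i) (FreeAlgebra.lift ℂ a P) = tensorState φ (freeDiff a i P)) :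
    fisher φ a ≤ ∑ i, ENNReal.ofReal (‖ξ i‖ ^ 2) := by
  -- The projection fixes every `toL2 φ (star x)` with `x` in the algebra, so moving it across the
  -- inner product leaves the expectations unchanged.
  have hη : IsConjugateSystem φ a ⊥ fun i => (l2Closure φ a).starProjection (ξ i) := by
    refine (isConjugateSystem_bot_iff _ _ _).2 ⟨fun i P => ?_, fun i =>
      Submodule.starProjection_apply_mem _ _⟩
    rw [← hξ, expect, expect, ← Submodule.inner_starProjection_left_eq_right,
      Submodule.starProjection_eq_self_iff.2
        (toL2_mem_l2Closure φ a (star_mem_adjoin ha (lift_mem_adjoin a P)))]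
  rw [fisher_eq_sum ha hη]
  gcongr
  exact Submodule.norm_starProjection_apply_le _ _

theorem isConjugateSystem_comp_equiv {J : Type*} {φ : M →ₚ[ℂ] ℂ} {a : I → M} (e : J ≃ I)
    {ξ : I → φ.GNS} (hξ : IsConjugateSystem φ a ⊥ ξ) :
    IsConjugateSystem φ (a ∘ e) ⊥ (ξ ∘ e) := by
  classical
  rw [isConjugateSystem_bot_iff] at hξ ⊢
  refine ⟨fun j P => ?_, fun j => ?_⟩
  · rw [← lift_map_equiv, Function.comp_apply, hξ.1, freeDiff_map_equiv]
  · have := hξ.2 (e j)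
    rwa [l2Closure, EquivLike.range_comp a e]

theorem fisher_comp_equiv {J : Type*} [Fintype I] [Fintype J] (φ : M →ₚ[ℂ] ℂ) {a : I → M}
    (ha : ∀ i, ∃ j, star (a i) = a j) (e : J ≃ I) : fisher φ (a ∘ e) = fisher φ a := by
  have ha' : ∀ i, ∃ j, star ((a ∘ e) i) = (a ∘ e) j := fun i => by
    obtain ⟨j, hj⟩ := ha (e i)
    exact ⟨e.symm j, by simpa using hj⟩
  by_cases h : ∃ ξ : I → φ.GNS, IsConjugateSystem φ a ⊥ ξ
  · obtain ⟨ξ, hξ⟩ := h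
    rw [fisher_eq_sum ha hξ, fisher_eq_sum ha' (isConjugateSystem_comp_equiv e hξ)]
    exact e.sum_comp fun i => ENNReal.ofReal (‖ξ i‖ ^ 2)
  · rw [fisher_eq_top h, fisher_eq_top]
    rintro ⟨ξ, hξ⟩
    refine h ⟨ξ ∘ e.symm, ?_⟩
    have := isConjugateSystem_comp_equiv e.symm hξ
    rwa [Function.comp_assoc, e.self_comp_symm, Function.comp_id] at this

end

/-! ### Matrix entries of vectors in `L²(M_d(M), φ_d)` -/

section

section MatrixUnit

variable {M : Type*} [CStarAlgebra M] {d : ℕ}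

/-- The entry `X ↦ X i j` as a linear map. -/
def entryₗ (i j : Fin d) : CStarMatrix (Fin d) (Fin d) M →ₗ[ℂ] M where
  toFun X := X i j
  map_add' _ _ := rfl
  map_smul' _ _ := rfl

@[simp]
theorem entryₗ_apply (i j : Fin d) (X : CStarMatrix (Fin d) (Fin d) M) : entryₗ i j X = X i j := rfl

/-- The matrix with entry `x` at `(i, j)` and zeros elsewhere. -/
def matUnit (i j : Fin d) : M →ₗ[ℂ] CStarMatrix (Fin d) (Fin d) M where
  toFun x := CStarMatrix.ofMatrix (Matrix.single i j x)
  map_add' x y := congrArg CStarMatrix.ofMatrix (Matrix.single_add i j x y)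
  map_smul' c x := congrArg CStarMatrix.ofMatrix (Matrix.smul_single c i j x).symm

theorem matUnit_apply (i j k l : Fin d) (x : M) :
    matUnit i j x k l = if i = k ∧ j = l then x else 0 := rfl

theorem matUnit_mul_apply (i j k l : Fin d) (x : M) (X : CStarMatrix (Fin d) (Fin d) M) :
    (matUnit i j x * X) k l = if i = k then x * X j l else 0 := by
  simp only [CStarMatrix.mul_apply, matUnit_apply, ite_and, ite_mul, zero_mul]
  split_ifs <;> simp

theorem mul_matUnit_apply (i j k l : Fin d) (x : M) (X : CStarMatrix (Fin d) (Fin d) M) :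
    (X * matUnit i j x) k l = if j = l then X k i * x else 0 := by
  simp only [CStarMatrix.mul_apply, matUnit_apply, ite_and, mul_ite, mul_zero]
  simp

end MatrixUnit

variable {M : Type*} [CStarAlgebra M] [PartialOrder M] [StarOrderedRing M]

section MatrixL2

variable (φ : M →ₚ[ℂ] ℂ) {d : ℕ}

theorem matrixState_mul (X Y : CStarMatrix (Fin d) (Fin d) M) :
    matrixState φ d (X * Y) = (d : ℂ)⁻¹ * ∑ i, ∑ j, φ (X i j * Y j i) := by
  simp [matrixState_apply, CStarMatrix.mul_apply, map_sum]

theorem matrixState_mul_comm (hφ : ∀ x y : M, φ (x * y) = φ (y * x))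
    (X Y : CStarMatrix (Fin d) (Fin d) M) :
    matrixState φ d (X * Y) = matrixState φ d (Y * X) := by
  rw [matrixState_mul, matrixState_mul, Finset.sum_comm]
  simp_rw [hφ]

theorem matrixState_one (hφ : φ 1 = 1) (hd : 0 < d) : matrixState φ d 1 = 1 := by
  have : (d : ℂ) ≠ 0 := by exact_mod_cast hd.ne'
  simp [matrixState_apply, hφ, this]

theorem inner_toL2_matrix (X Y : CStarMatrix (Fin d) (Fin d) M) :
    inner ℂ (toL2 (matrixState φ d) X) (toL2 (matrixState φ d) Y) =
      (d : ℂ)⁻¹ * ∑ i, ∑ j, inner ℂ (toL2 φ (X i j)) (toL2 φ (Y i j)) := by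
  simp only [inner_toL2, matrixState_mul, CStarMatrix.star_apply]
  rw [Finset.sum_comm]

theorem norm_sq_toL2_matrix (X : CStarMatrix (Fin d) (Fin d) M) :
    ‖toL2 (matrixState φ d) X‖ ^ 2 = (d : ℝ)⁻¹ * ∑ i, ∑ j, ‖toL2 φ (X i j)‖ ^ 2 := by
  have := inner_toL2_matrix φ X X
  simp only [inner_self_eq_norm_sq_to_K] at this
  apply Complex.ofReal_injective
  push_cast
  exact this

/-- The factor `√d` undoes the normalisation `1 / d` of `φ_d`. This bound lets the entry maps extend
to the completion. -/
theorem norm_toL2_entry_le (i j : Fin d) (X : CStarMatrix (Fin d) (Fin d) M) :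
    ‖toL2 φ (X i j)‖ ≤ √d * ‖toL2 (matrixState φ d) X‖ := by
  have hd : (d : ℝ) ≠ 0 := by exact_mod_cast (Fin.pos i).ne'
  rw [← sq_le_sq₀ (by positivity) (by positivity), mul_pow, Real.sq_sqrt (by positivity),
    norm_sq_toL2_matrix, mul_inv_cancel_left₀ hd]
  calc ‖toL2 φ (X i j)‖ ^ 2 ≤ ∑ j, ‖toL2 φ (X i j)‖ ^ 2 :=
        Finset.single_le_sum (f := fun j => ‖toL2 φ (X i j)‖ ^ 2) (fun _ _ => by positivity)
          (Finset.mem_univ j)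
    _ ≤ _ := Finset.single_le_sum (f := fun i => ∑ j, ‖toL2 φ (X i j)‖ ^ 2)
          (fun _ _ => by positivity) (Finset.mem_univ i)

theorem toL2_zero : toL2 φ 0 = 0 := (toL2ₗ φ).map_zero

theorem norm_toL2_matUnit_le (i j : Fin d) (x : M) :
    ‖toL2 (matrixState φ d) (matUnit i j x)‖ ≤ 1 * ‖toL2 φ x‖ := by
  have hd : 0 < d := Fin.pos i
  rw [← sq_le_sq₀ (by positivity) (by positivity), norm_sq_toL2_matrix, one_mul]
  have : ∑ k, ∑ l, ‖toL2 φ (matUnit i j x k l)‖ ^ 2 = ‖toL2 φ x‖ ^ 2 := by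
    rw [Finset.sum_eq_single i, Finset.sum_eq_single j]
    · simp [matUnit_apply]
    · intro l _ hl
      simp [matUnit_apply, hl.symm, toL2_zero]
    · simp
    · intro k _ hk
      simp [matUnit_apply, hk.symm, toL2_zero]
    · simp
  rw [this]
  exact mul_le_of_le_one_left (by positivity) (inv_le_one_of_one_le₀ (by exact_mod_cast hd))

/-- The entry map `L²(M_d(M)) → L²(M)`. -/
def entryL2 (i j : Fin d) : (matrixState φ d).GNS →L[ℂ] φ.GNS :=
  LinearMap.extendOfNorm (toL2ₗ φ ∘ₗ entryₗ i j) (toL2ₗ (matrixState φ d))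

@[simp]
theorem entryL2_toL2 (i j : Fin d) (X : CStarMatrix (Fin d) (Fin d) M) :
    entryL2 φ i j (toL2 (matrixState φ d) X) = toL2 φ (X i j) :=
  LinearMap.extendOfNorm_eq (denseRange_toL2ₗ _) ⟨_, norm_toL2_entry_le φ i j⟩ X

/-- The embedding `L²(M) → L²(M_d(M))` into the entry `(i, j)`. -/
def matUnitL2 (i j : Fin d) : φ.GNS →L[ℂ] (matrixState φ d).GNS :=
  LinearMap.extendOfNorm (toL2ₗ (matrixState φ d) ∘ₗ matUnit i j) (toL2ₗ φ)

@[simp]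
theorem matUnitL2_toL2 (i j : Fin d) (x : M) :
    matUnitL2 φ i j (toL2 φ x) = toL2 (matrixState φ d) (matUnit i j x) :=
  LinearMap.extendOfNorm_eq (denseRange_toL2ₗ _) ⟨_, norm_toL2_matUnit_le φ i j⟩ x

variable {φ}

theorem toL2_induction {p : φ.GNS → Prop} (hp : IsClosed {ξ | p ξ}) (h : ∀ x, p (toL2 φ x))
    (ξ : φ.GNS) : p ξ :=
  (denseRange_toL2ₗ φ).induction_on ξ hp h

theorem entryL2_matUnitL2 (i j k l : Fin d) (ξ : φ.GNS) :
    entryL2 φ k l (matUnitL2 φ i j ξ) = if i = k ∧ j = l then ξ else 0 := by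
  induction ξ using toL2_induction with
  | hp =>
    refine isClosed_eq (by fun_prop) ?_
    split_ifs <;> fun_prop
  | h x =>
    rw [matUnitL2_toL2, entryL2_toL2, matUnit_apply]
    split_ifs <;> simp [toL2_zero]

theorem exists_entryL2_eq (η : Fin d → Fin d → φ.GNS) :
    ∃ ξ : (matrixState φ d).GNS, ∀ i j, entryL2 φ i j ξ = η i j := by
  refine ⟨∑ i, ∑ j, matUnitL2 φ i j (η i j), fun i j => ?_⟩
  simp only [map_sum, entryL2_matUnitL2, ite_and]
  simp

theorem inner_matrix (ξ η : (matrixState φ d).GNS) :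
    inner ℂ ξ η = (d : ℂ)⁻¹ * ∑ i, ∑ j, inner ℂ (entryL2 φ i j ξ) (entryL2 φ i j η) := by
  induction ξ using toL2_induction with
  | hp => exact isClosed_eq (by fun_prop) (by fun_prop)
  | h x =>
    induction η using toL2_induction with
    | hp => exact isClosed_eq (by fun_prop) (by fun_prop)
    | h y => simp only [inner_toL2_matrix, entryL2_toL2]

theorem norm_sq_matrix (ξ : (matrixState φ d).GNS) :
    ‖ξ‖ ^ 2 = (d : ℝ)⁻¹ * ∑ i, ∑ j, ‖entryL2 φ i j ξ‖ ^ 2 := by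
  have := inner_matrix ξ ξ
  simp only [inner_self_eq_norm_sq_to_K] at this
  apply Complex.ofReal_injective
  push_cast
  exact this

/-- The trace pairs the `(i, j)` entry of the vector with the `(j, i)` entry of `X`, hence the
transposed indices in the conjugate systems built below. -/
theorem expect_matrix (ξ : (matrixState φ d).GNS) (X : CStarMatrix (Fin d) (Fin d) M) :
    expect (matrixState φ d) ξ X = (d : ℂ)⁻¹ * ∑ i, ∑ j, expect φ (entryL2 φ i j ξ) (X j i) := by
  simp only [expect, inner_matrix, entryL2_toL2, CStarMatrix.star_apply]

end MatrixL2

end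

/-! ### Difference quotients of matrix entries and the inequality -/

section

section Entries

variable {M : Type*} [CStarAlgebra M] {d : ℕ} {K : Type*}

/-- The family of the entries of a family of matrices. -/
def entries (A : K → CStarMatrix (Fin d) (Fin d) M) : (Fin d × Fin d) × K → M :=
  fun p => A p.2 p.1.1 p.1.2

/-- The homomorphism from noncommutative polynomials to matrices over noncommutative polynomials
that replaces each variable by a matrix of variables. -/
def genericMatrix (d : ℕ) (K : Type*) :
    FreeAlgebra ℂ K →ₐ[ℂ] Matrix (Fin d) (Fin d) (FreeAlgebra ℂ ((Fin d × Fin d) × K)) :=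
  FreeAlgebra.lift ℂ fun k => Matrix.of fun i j => FreeAlgebra.ι ℂ ((i, j), k)

theorem lift_entries_genericMatrix (A : K → CStarMatrix (Fin d) (Fin d) M) (P : FreeAlgebra ℂ K)
    (r s : Fin d) :
    FreeAlgebra.lift ℂ (entries A) (genericMatrix d K P r s) = FreeAlgebra.lift ℂ A P r s := by
  induction P using FreeAlgebra.induction generalizing r s with
  | grade0 c =>
    rw [AlgHom.commutes, AlgHom.commutes, Matrix.algebraMap_matrix_apply,
      CStarMatrix.algebraMap_apply]
    split_ifs <;> simp
  | grade1 k => simp [genericMatrix, entries]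
  | mul P Q hP hQ => simp [Matrix.mul_apply, CStarMatrix.mul_apply, hP, hQ]
  | add P Q hP hQ => simp [hP, hQ]

/-- The map `X ⊗ Y ↦ X r p ⊗ Y q s`. -/
def compress (r p q s : Fin d) :
    CStarMatrix (Fin d) (Fin d) M ⊗[ℂ] CStarMatrix (Fin d) (Fin d) M →ₗ[ℂ] M ⊗[ℂ] M :=
  TensorProduct.map (entryₗ r p) (entryₗ q s)

@[simp]
theorem compress_tmul (r p q s : Fin d) (X Y : CStarMatrix (Fin d) (Fin d) M) :
    compress r p q s (X ⊗ₜ Y) = X r p ⊗ₜ Y q s := rfl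

variable [PartialOrder M] [StarOrderedRing M]

theorem compress_left_mul (r p q s : Fin d) (X : CStarMatrix (Fin d) (Fin d) M)
    (T : CStarMatrix (Fin d) (Fin d) M ⊗[ℂ] CStarMatrix (Fin d) (Fin d) M) :
    compress r p q s (X ⊗ₜ 1 * T) = ∑ t, X r t ⊗ₜ 1 * compress t p q s T := by
  induction T using TensorProduct.induction_on with
  | zero => simp
  | tmul Y Z => simp [CStarMatrix.mul_apply, TensorProduct.sum_tmul]
  | add T S hT hS => simp [mul_add, hT, hS, Finset.sum_add_distrib]

theorem compress_mul_right (r p q s : Fin d) (X : CStarMatrix (Fin d) (Fin d) M)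
    (T : CStarMatrix (Fin d) (Fin d) M ⊗[ℂ] CStarMatrix (Fin d) (Fin d) M) :
    compress r p q s (T * 1 ⊗ₜ X) = ∑ t, compress r p q t T * 1 ⊗ₜ X t s := by
  induction T using TensorProduct.induction_on with
  | zero => simp
  | tmul Y Z => simp [CStarMatrix.mul_apply, TensorProduct.tmul_sum]
  | add T S hT hS => simp [add_mul, hT, hS, Finset.sum_add_distrib]

variable [DecidableEq K]

/-- An entry of a product is a sum over index paths. Removing a step from `p` to `q` cuts a path
from `r` to `s` into one from `r` to `p` and one from `q` to `s`. -/
theorem freeDiff_genericMatrix (A : K → CStarMatrix (Fin d) (Fin d) M) (P : FreeAlgebra ℂ K)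
    (p q r s : Fin d) (k : K) :
    freeDiff (entries A) ((p, q), k) (genericMatrix d K P r s) =
      compress r p q s (freeDiff A k P) := by
  induction P using FreeAlgebra.induction generalizing r s with
  | grade0 c =>
    rw [AlgHom.commutes, Matrix.algebraMap_matrix_apply]
    split_ifs <;> simp [freeDiff]
  | grade1 l =>
    simp only [genericMatrix, FreeAlgebra.lift_ι_apply, Matrix.of_apply, freeDiff, der_ι,
      Prod.mk.injEq]
    by_cases hk : k = l
    · by_cases hp : p = r
      · by_cases hq : q = s
        · simp [hk, hp, hq, Algebra.TensorProduct.one_def]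
        · simp [hk, hq, Algebra.TensorProduct.one_def]
      · simp [hk, hp, Algebra.TensorProduct.one_def, CStarMatrix.one_apply_ne (Ne.symm hp)]
    · simp [hk]
  | mul P Q hP hQ =>
    simp only [freeDiff, der_mul, map_mul, Matrix.mul_apply, map_sum, map_add, compress_left_mul,
      compress_mul_right, lift_entries_genericMatrix, Finset.sum_add_distrib] at hP hQ ⊢
    simp only [hP, hQ]
  | add P Q hP hQ => simp [hP, hQ]

end Entries

variable {M : Type*} [CStarAlgebra M] [PartialOrder M] [StarOrderedRing M]
  {φ : M →ₚ[ℂ] ℂ} {d : ℕ} {K : Type*}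

theorem tensorState_matrixState
    (T : CStarMatrix (Fin d) (Fin d) M ⊗[ℂ] CStarMatrix (Fin d) (Fin d) M) :
    tensorState (matrixState φ d) T =
      (d : ℂ)⁻¹ * ∑ i, ∑ j, (d : ℂ)⁻¹ * tensorState φ (compress j j i i T) := by
  induction T using TensorProduct.induction_on with
  | zero => simp
  | tmul X Y =>
    simp only [tensorState_tmul, matrixState_apply, compress_tmul, Finset.mul_sum, Finset.sum_mul]
    exact Finset.sum_congr rfl fun i _ => Finset.sum_congr rfl fun j _ => by ring
  | add T S hT hS => simp [mul_add, hT, hS, Finset.sum_add_distrib]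

theorem expect_smul (c : ℂ) (ξ : φ.GNS) (x : M) : expect φ (c • ξ) x = c * expect φ ξ x :=
  inner_smul_right _ _ _

/-- The Fisher information of a family of matrices is dominated by that of their entries. -/
theorem fisher_matrix_le [Fintype K] (hd : 0 < d) {A : K → CStarMatrix (Fin d) (Fin d) M}
    (hA : ∀ i, ∃ j, star (A i) = A j) (hA' : ∀ i, ∃ j, star (entries A i) = entries A j) :
    (d : ℝ≥0∞) ^ 3 * fisher (matrixState φ d) A ≤ fisher φ (entries A) := by
  classical
  by_cases h : ∃ ξ, IsConjugateSystem φ (entries A) ⊥ ξ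
  · obtain ⟨ξ, hξ⟩ := h
    rw [fisher_eq_sum hA' hξ]
    rw [isConjugateSystem_bot_iff] at hξ
    -- Indices are transposed to match `expect_matrix`; the scalar `d⁻¹` supplies the second
    -- normalising factor of `φ_d ⊗ φ_d`.
    choose η hη using fun k : K => exists_entryL2_eq (φ := φ)
      fun i j : Fin d => (d : ℂ)⁻¹ • ξ ((j, i), k)
    have hle := fisher_le_sum (φ := matrixState φ d) hA (ξ := η) fun k P => by
      rw [expect_matrix, tensorState_matrixState]
      simp only [hη, expect_smul, ← lift_entries_genericMatrix, hξ.1, freeDiff_genericMatrix]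
    refine (mul_le_mul_right hle _).trans ?_
    rw [Finset.mul_sum, Fintype.sum_prod_type_right]
    refine Finset.sum_le_sum fun k _ => le_of_eq ?_
    -- The squared norm of `η k` carries `d⁻¹` from `φ_d` and `d⁻²` from the scalar, cancelling
    -- `d³`.
    rw [norm_sq_matrix, ← ENNReal.ofReal_sum_of_nonneg fun _ _ => by positivity,
      ← ENNReal.ofReal_natCast, ← ENNReal.ofReal_pow (by positivity),
      ← ENNReal.ofReal_mul (by positivity), Fintype.sum_prod_type_right]
    have : (d : ℝ) ≠ 0 := by exact_mod_cast hd.ne'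
    simp only [hη, norm_smul, mul_pow, norm_inv, Complex.norm_natCast, ← Finset.mul_sum]
    field_simp
  · rw [fisher_eq_top h]
    exact le_top

end

/-! ### Alternating words of centred elements -/

section

section CentredWord

variable {R ι : Type*} [Ring R]

/-- The product of the letters of a word. -/
def wordProd (l : List (ι × R)) : R := (l.map Prod.snd).prod

@[simp]
theorem wordProd_nil : wordProd ([] : List (ι × R)) = 1 := rfl

@[simp]
theorem wordProd_cons (p : ι × R) (l : List (ι × R)) : wordProd (p :: l) = p.2 * wordProd l := by
  simp [wordProd]

@[simp]
theorem wordProd_append (l m : List (ι × R)) : wordProd (l ++ m) = wordProd l * wordProd m := by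
  simp [wordProd]

variable [Algebra ℂ R] {U : ι → Subalgebra ℂ R} {ε : R →ₗ[ℂ] ℂ}

/-- An alternating word of centred elements of the subalgebras `U i`. -/
structure CentredWord (U : ι → Subalgebra ℂ R) (ε : R →ₗ[ℂ] ℂ) (l : List (ι × R)) : Prop where
  chain : l.IsChain fun p q => p.1 ≠ q.1
  mem : ∀ p ∈ l, p.2 ∈ U p.1
  centred : ∀ p ∈ l, ε p.2 = 0

theorem centredWord_nil : CentredWord U ε [] := ⟨by simp, by simp, by simp⟩

theorem centredWord_append {l m : List (ι × R)} :
    CentredWord U ε (l ++ m) ↔ CentredWord U ε l ∧ CentredWord U ε m ∧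
      ∀ p ∈ l.getLast?, ∀ q ∈ m.head?, p.1 ≠ q.1 := by
  constructor
  · rintro ⟨h, h', h''⟩
    rw [List.isChain_append] at h
    exact ⟨⟨h.1, fun p hp => h' p (by simp [hp]), fun p hp => h'' p (by simp [hp])⟩,
      ⟨h.2.1, fun p hp => h' p (by simp [hp]), fun p hp => h'' p (by simp [hp])⟩, h.2.2⟩
  · rintro ⟨hl, hm, h⟩
    refine ⟨List.isChain_append.2 ⟨hl.1, hm.1, h⟩, fun p hp => ?_, fun p hp => ?_⟩
    · exact (List.mem_append.1 hp).elim (hl.2 p) (hm.2 p)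
    · exact (List.mem_append.1 hp).elim (hl.3 p) (hm.3 p)

theorem centredWord_singleton {p : ι × R} :
    CentredWord U ε [p] ↔ p.2 ∈ U p.1 ∧ ε p.2 = 0 :=
  ⟨fun h => ⟨h.2 p (by simp), h.3 p (by simp)⟩,
    fun h => ⟨by simp, by simpa using h.1, by simpa using h.2⟩⟩

theorem centredWord_cons {p : ι × R} {l : List (ι × R)} :
    CentredWord U ε (p :: l) ↔ (p.2 ∈ U p.1 ∧ ε p.2 = 0) ∧ CentredWord U ε l ∧
      ∀ q ∈ l.head?, p.1 ≠ q.1 := by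
  rw [← List.singleton_append, centredWord_append, centredWord_singleton]
  simp

/-- The centred part of an element. -/
def centre (ε : R →ₗ[ℂ] ℂ) (x : R) : R := x - ε x • 1

theorem centre_mem {i : ι} {x : R} (hx : x ∈ U i) : centre ε x ∈ U i :=
  sub_mem hx (Subalgebra.smul_mem _ (one_mem _) _)

theorem apply_centre (hε : ε 1 = 1) (x : R) : ε (centre ε x) = 0 := by
  simp [centre, hε]

theorem eq_centre_add (ε : R →ₗ[ℂ] ℂ) (x : R) : x = centre ε x + ε x • 1 := by
  simp [centre]

variable (U ε) in
/-- The span of the products of alternating words of centred elements. -/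
def centredSpan : Submodule ℂ R := Submodule.span ℂ {x | ∃ l, CentredWord U ε l ∧ wordProd l = x}

theorem wordProd_mem_centredSpan {l : List (ι × R)} (hl : CentredWord U ε l) :
    wordProd l ∈ centredSpan U ε := Submodule.subset_span ⟨l, hl, rfl⟩

theorem mul_wordProd_mem_centredSpan (hε : ε 1 = 1) {i : ι} {x : R} (hx : x ∈ U i)
    {l : List (ι × R)} (hl : CentredWord U ε l) (hi : ∀ q ∈ l.head?, i ≠ q.1) :
    x * wordProd l ∈ centredSpan U ε := by
  rw [eq_centre_add ε x, add_mul, smul_one_mul]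
  refine add_mem ?_ (Submodule.smul_mem _ _ (wordProd_mem_centredSpan hl))
  exact wordProd_mem_centredSpan (l := (i, centre ε x) :: l)
    (centredWord_cons.2 ⟨⟨centre_mem hx, apply_centre hε x⟩, hl, hi⟩)

/-- If the word begins in the same subalgebra as `x`, the two letters merge into one. Splitting that
letter into its centred part and a scalar gives two alternating centred words. -/
theorem mul_mem_centredSpan (hε : ε 1 = 1) {i : ι} {x : R} (hx : x ∈ U i) {y : R}
    (hy : y ∈ centredSpan U ε) : x * y ∈ centredSpan U ε := by
  induction hy using Submodule.span_induction with
  | zero => simp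
  | add y z _ _ hy hz => rw [mul_add]; exact add_mem hy hz
  | smul c y _ hy => rw [mul_smul_comm]; exact Submodule.smul_mem _ _ hy
  | mem y hy =>
    obtain ⟨l, hl, rfl⟩ := hy
    by_cases hi : ∀ q ∈ l.head?, i ≠ q.1
    · exact mul_wordProd_mem_centredSpan hε hx hl hi
    · cases l with
      | nil => simp at hi
      | cons p l =>
        obtain ⟨j, y⟩ := p
        obtain rfl : i = j := by simpa using hi
        rw [centredWord_cons] at hl
        rw [wordProd_cons, ← mul_assoc]
        exact mul_wordProd_mem_centredSpan hε (mul_mem hx hl.1.1) hl.2.1 hl.2.2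

/-- The elements whose left multiplication preserves the span form a subalgebra containing every `U
i`, and the span contains `1` as the empty word. -/
theorem centredSpan_eq_top (hε : ε 1 = 1) (hU : ⨆ i, U i = ⊤) : centredSpan U ε = ⊤ := by
  let S : Subalgebra ℂ R :=
    { carrier := {x | ∀ y ∈ centredSpan U ε, x * y ∈ centredSpan U ε}
      mul_mem' := fun {x y} hx hy z hz => by rw [mul_assoc]; exact hx _ (hy _ hz)
      add_mem' := fun {x y} hx hy z hz => by rw [add_mul]; exact add_mem (hx _ hz) (hy _ hz)
      algebraMap_mem' := fun c z hz => by
        rw [← Algebra.smul_def]; exact Submodule.smul_mem _ _ hz }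
  have hS : S = ⊤ := top_le_iff.1 <| hU ▸ iSup_le fun i x hx y hy => mul_mem_centredSpan hε hx hy
  refine top_le_iff.1 fun x _ => ?_
  have hx : x ∈ S := hS ▸ Algebra.mem_top
  simpa using hx 1 (wordProd_mem_centredSpan centredWord_nil)

variable (hε : ε 1 = 1) (hfree : ∀ l, CentredWord U ε l → l ≠ [] → ε (wordProd l) = 0)
include hε hfree

/-- Both the centred and the scalar part of `x` leave a nonempty alternating centred word, so `x`
need not be centred. -/
theorem apply_mul_wordProd {i : ι} {x : R} (hx : x ∈ U i) {l : List (ι × R)}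
    (hl : CentredWord U ε l) (hne : l ≠ []) (hi : ∀ q ∈ l.head?, i ≠ q.1) :
    ε (x * wordProd l) = 0 := by
  rw [eq_centre_add ε x, add_mul, smul_one_mul, map_add, map_smul, hfree l hl hne, smul_zero,
    add_zero]
  exact hfree ((i, centre ε x) :: l)
    (centredWord_cons.2 ⟨⟨centre_mem hx, apply_centre hε x⟩, hl, hi⟩) (by simp)

theorem apply_wordProd_mul {i : ι} {x : R} (hx : x ∈ U i) {l : List (ι × R)}
    (hl : CentredWord U ε l) (hne : l ≠ []) (hi : ∀ q ∈ l.getLast?, q.1 ≠ i) :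
    ε (wordProd l * x) = 0 := by
  rw [eq_centre_add ε x, mul_add, mul_smul_one, map_add, map_smul, hfree l hl hne, smul_zero,
    add_zero]
  have := hfree (l ++ [(i, centre ε x)])
    (centredWord_append.2 ⟨hl, centredWord_singleton.2 ⟨centre_mem hx, apply_centre hε x⟩,
      fun p hp q hq => by
        obtain rfl : (i, centre ε x) = q := by simpa using hq
        exact hi p hp⟩) (by simp)
  simpa using this

end CentredWord

variable {M : Type*} [CStarAlgebra M] [PartialOrder M] {φ : M →ₚ[ℂ] ℂ}

theorem IsFree.apply_wordProd {ι : Type*} {S : ι → Set M} (h : IsFree φ S) {l : List (ι × M)}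
    (hl : CentredWord (fun i => Algebra.adjoin ℂ (S i)) φ.toLinearMap l) (hne : l ≠ []) :
    φ (wordProd l) = 0 := by
  -- `IsFree` indexes letters by `Fin (n + 1)`, so the length must be a successor.
  obtain ⟨n, hn⟩ := Nat.exists_eq_succ_of_ne_zero (mt List.length_eq_zero_iff.1 hne)
  have := h n (fun k => (l[k]'(by omega)).1) (fun k => (l[k]'(by omega)).2)
    (fun k => hl.2 _ (List.getElem_mem _)) (fun k => hl.3 _ (List.getElem_mem _))
    (fun k => List.isChain_iff_getElem.1 hl.1 k (by omega))
  refine Eq.trans (congrArg (fun m : List M => φ m.prod) ?_) this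
  refine List.ext_getElem (by simp [hn]) fun k h₁ h₂ => ?_
  rw [List.getElem_map, List.getElem_ofFn]
  rfl

end

/-! ### Conjugate relations in the presence of a free family -/

section

section Inclusion

variable {M : Type*} [CStarAlgebra M] {I J : Type*}

/-- The polynomials in the first, respectively second, group of variables. -/
def variableAlgebras (I J : Type*) : Fin 2 → Subalgebra ℂ (FreeAlgebra ℂ (I ⊕ J)) :=
  ![(FreeAlgebra.lift ℂ (FreeAlgebra.ι ℂ ∘ Sum.inl)).range,
    (FreeAlgebra.lift ℂ (FreeAlgebra.ι ℂ ∘ Sum.inr)).range]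

theorem iSup_variableAlgebras : ⨆ i, variableAlgebras I J i = ⊤ := by
  rw [← top_le_iff, ← FreeAlgebra.adjoin_range_ι]
  refine Algebra.adjoin_le ?_
  rintro _ ⟨s | s, rfl⟩
  · exact le_iSup (variableAlgebras I J) 0 ⟨FreeAlgebra.ι ℂ s, by simp⟩
  · exact le_iSup (variableAlgebras I J) 1 ⟨FreeAlgebra.ι ℂ s, by simp⟩

variable (a : I → M) (b : J → M)

theorem lift_elim_lift_inl (P : FreeAlgebra ℂ I) :
    FreeAlgebra.lift ℂ (Sum.elim a b) (FreeAlgebra.lift ℂ (FreeAlgebra.ι ℂ ∘ Sum.inl) P) =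
      FreeAlgebra.lift ℂ a P := by
  rw [← AlgHom.comp_apply]
  congr 1
  ext j
  simp

theorem lift_elim_lift_inr (P : FreeAlgebra ℂ J) :
    FreeAlgebra.lift ℂ (Sum.elim a b) (FreeAlgebra.lift ℂ (FreeAlgebra.ι ℂ ∘ Sum.inr) P) =
      FreeAlgebra.lift ℂ b P := by
  rw [← AlgHom.comp_apply]
  congr 1
  ext j
  simp

theorem lift_elim_mem_adjoin {i : Fin 2} {P : FreeAlgebra ℂ (I ⊕ J)}
    (hP : P ∈ variableAlgebras I J i) :
    FreeAlgebra.lift ℂ (Sum.elim a b) P ∈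
      Algebra.adjoin ℂ ((![Set.range a, Set.range b] : Fin 2 → Set M) i) := by
  fin_cases i
  · obtain ⟨Q, rfl⟩ := hP
    erw [lift_elim_lift_inl]
    exact lift_mem_adjoin a Q
  · obtain ⟨Q, rfl⟩ := hP
    erw [lift_elim_lift_inr]
    exact lift_mem_adjoin b Q

variable [DecidableEq I] [DecidableEq J]

theorem freeDiff_lift_inl (i : I) (P : FreeAlgebra ℂ I) :
    freeDiff (Sum.elim a b) (Sum.inl i) (FreeAlgebra.lift ℂ (FreeAlgebra.ι ℂ ∘ Sum.inl) P) =
      freeDiff a i P := by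
  induction P using FreeAlgebra.induction with
  | grade0 r => simp [freeDiff]
  | grade1 k => simp [freeDiff]
  | mul P Q hP hQ =>
    simp only [freeDiff, map_mul, der_mul, lift_elim_lift_inl] at hP hQ ⊢
    rw [hP, hQ]
  | add P Q hP hQ => simp only [map_add, hP, hQ]

theorem freeDiff_lift_inr (i : I) (P : FreeAlgebra ℂ J) :
    freeDiff (Sum.elim a b) (Sum.inl i) (FreeAlgebra.lift ℂ (FreeAlgebra.ι ℂ ∘ Sum.inr) P) = 0 := by
  induction P using FreeAlgebra.induction with
  | grade0 r => simp [freeDiff]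
  | grade1 k => simp [freeDiff]
  | mul P Q hP hQ =>
    simp only [freeDiff, map_mul, der_mul] at hP hQ ⊢
    rw [hP, hQ]
    simp
  | add P Q hP hQ => simp only [map_add, hP, hQ, add_zero]

/-- Difference quotients of polynomials in the first group of variables are combinations of tensors
of such polynomials. -/
theorem freeDiff_mem_span (i : I) {P : FreeAlgebra ℂ (I ⊕ J)}
    (hP : P ∈ variableAlgebras I J 0) :
    freeDiff (Sum.elim a b) (Sum.inl i) P ∈ Submodule.span ℂ
      {T | ∃ u ∈ variableAlgebras I J 0, ∃ v ∈ variableAlgebras I J 0,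
        FreeAlgebra.lift ℂ (Sum.elim a b) u ⊗ₜ[ℂ] FreeAlgebra.lift ℂ (Sum.elim a b) v = T} := by
  set V := Submodule.span ℂ
      {T | ∃ u ∈ variableAlgebras I J 0, ∃ v ∈ variableAlgebras I J 0,
        FreeAlgebra.lift ℂ (Sum.elim a b) u ⊗ₜ[ℂ] FreeAlgebra.lift ℂ (Sum.elim a b) v = T}
  -- `V` is stable under the two one-sided multiplications in the Leibniz rule, so induction on the
  -- polynomial stays in `V`.
  have hleft : ∀ u ∈ variableAlgebras I J 0, ∀ T ∈ V,
      (FreeAlgebra.lift ℂ (Sum.elim a b) u ⊗ₜ[ℂ] (1 : M)) * T ∈ V := by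
    intro u hu T hT
    induction hT using Submodule.span_induction with
    | zero => simp
    | add y z _ _ hy hz => rw [mul_add]; exact add_mem hy hz
    | smul c y _ hy => rw [mul_smul_comm]; exact Submodule.smul_mem _ _ hy
    | mem y hy =>
      obtain ⟨v, hv, w, hw, rfl⟩ := hy
      exact Submodule.subset_span ⟨u * v, mul_mem hu hv, w, hw, by simp⟩
  have hright : ∀ u ∈ variableAlgebras I J 0, ∀ T ∈ V,
      T * ((1 : M) ⊗ₜ[ℂ] FreeAlgebra.lift ℂ (Sum.elim a b) u) ∈ V := by
    intro u hu T hT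
    induction hT using Submodule.span_induction with
    | zero => simp
    | add y z _ _ hy hz => rw [add_mul]; exact add_mem hy hz
    | smul c y _ hy => rw [smul_mul_assoc]; exact Submodule.smul_mem _ _ hy
    | mem y hy =>
      obtain ⟨v, hv, w, hw, rfl⟩ := hy
      exact Submodule.subset_span ⟨v, hv, w * u, mul_mem hw hu, by simp⟩
  obtain ⟨Q, rfl⟩ := hP
  induction Q using FreeAlgebra.induction with
  | grade0 r => simp [freeDiff]
  | grade1 k =>
    by_cases hk : i = k
    · refine Submodule.subset_span ⟨1, one_mem _, 1, one_mem _, ?_⟩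
      simp [freeDiff, hk, Algebra.TensorProduct.one_def]
    · simp [freeDiff, hk]
  | mul P Q hP hQ =>
    simp only [freeDiff] at hP hQ ⊢
    erw [map_mul, der_mul]
    exact add_mem (hleft _ ⟨P, rfl⟩ _ hQ) (hright _ ⟨Q, rfl⟩ _ hP)
  | add P Q hP hQ =>
    erw [map_add, map_add]
    exact add_mem hP hQ

variable {a b} in
theorem freeDiff_eq_zero_of_mem (i : I) {P : FreeAlgebra ℂ (I ⊕ J)}
    (hP : P ∈ variableAlgebras I J 1) : freeDiff (Sum.elim a b) (Sum.inl i) P = 0 := by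
  obtain ⟨Q, rfl⟩ := hP
  exact freeDiff_lift_inr a b i Q

end Inclusion

variable {M : Type*} [CStarAlgebra M] [PartialOrder M] {φ : M →ₚ[ℂ] ℂ} {I J : Type*}

/-- The functional `P ↦ φ (P (a, b))`. -/
def evalState (φ : M →ₚ[ℂ] ℂ) (c : I → M) : FreeAlgebra ℂ I →ₗ[ℂ] ℂ :=
  φ.toLinearMap ∘ₗ (FreeAlgebra.lift ℂ c).toLinearMap

theorem evalState_apply (c : I → M) (P : FreeAlgebra ℂ I) :
    evalState φ c P = φ (FreeAlgebra.lift ℂ c P) := rfl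

/-- Freeness is pulled back to polynomials because the difference quotients are defined on
polynomials, not on elements of `M`. -/
theorem evalState_wordProd {a : I → M} {b : J → M}
    (h : IsFree φ ![Set.range a, Set.range b]) (l : List (Fin 2 × FreeAlgebra ℂ (I ⊕ J)))
    (hl : CentredWord (variableAlgebras I J) (evalState φ (Sum.elim a b)) l) (hne : l ≠ []) :
    evalState φ (Sum.elim a b) (wordProd l) = 0 := by
  have := h.apply_wordProd
    (l := l.map fun p => (p.1, FreeAlgebra.lift ℂ (Sum.elim a b) p.2)) ⟨?_, ?_, ?_⟩ (by simpa)
  · rw [evalState_apply, wordProd, map_list_prod]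
    simpa [wordProd, Function.comp_def] using this
  · rw [List.isChain_map]
    exact hl.1
  · intro p hp
    obtain ⟨q, hq, rfl⟩ := List.mem_map.1 hp
    exact lift_elim_mem_adjoin a b (hl.2 q hq)
  · intro p hp
    obtain ⟨q, hq, rfl⟩ := List.mem_map.1 hp
    exact hl.3 q hq

section

variable [DecidableEq I] [DecidableEq J] {a : I → M} {b : J → M}
  (hφ : φ 1 = 1) (h : IsFree φ ![Set.range a, Set.range b])

theorem tensorState_mul_freeDiff_mul_eq_zero (i : I) {u x v : FreeAlgebra ℂ (I ⊕ J)}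
    (hx : x ∈ variableAlgebras I J 0)
    (huv : ∀ p ∈ variableAlgebras I J 0, ∀ q ∈ variableAlgebras I J 0,
      evalState φ (Sum.elim a b) (u * p) * evalState φ (Sum.elim a b) (q * v) = 0) :
    tensorState φ ((FreeAlgebra.lift ℂ (Sum.elim a b) u ⊗ₜ 1) *
      (freeDiff (Sum.elim a b) (Sum.inl i) x *
        (1 ⊗ₜ FreeAlgebra.lift ℂ (Sum.elim a b) v))) = 0 := by
  have := freeDiff_mem_span a b i hx
  generalize freeDiff (Sum.elim a b) (Sum.inl i) x = T at this ⊢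
  induction this using Submodule.span_induction with
  | zero => simp
  | add y z _ _ hy hz => rw [add_mul, mul_add, map_add, hy, hz, add_zero]
  | smul c y _ hy => rw [smul_mul_assoc, mul_smul_comm, map_smul, hy, smul_zero]
  | mem y hy =>
    obtain ⟨p, hp, q, hq, rfl⟩ := hy
    simpa [evalState_apply] using huv p hp q hq

include hφ h

/-- By the Leibniz rule, each letter `x` of `l` in the `a`-variables gives terms with left factor `φ
(w' p)`. Here `w'` is everything before `x` and `p` a polynomial in `a`. As `w'` is nonempty and
ends in a `b`-letter, this factor is zero. -/
theorem tensorState_mul_freeDiff_wordProd (i : I)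
    {w l : List (Fin 2 × FreeAlgebra ℂ (I ⊕ J))} (hw : w ≠ [])
    (hl : CentredWord (variableAlgebras I J) (evalState φ (Sum.elim a b)) (w ++ l)) :
    tensorState φ ((FreeAlgebra.lift ℂ (Sum.elim a b) (wordProd w) ⊗ₜ 1) *
      freeDiff (Sum.elim a b) (Sum.inl i) (wordProd l)) = 0 := by
  induction l generalizing w with
  | nil => simp [freeDiff]
  | cons p l ih =>
    obtain ⟨j, x⟩ := p
    have hl' := hl
    rw [List.append_cons] at hl'
    have := ih (by simp) hl'
    rw [wordProd_append, wordProd_cons, wordProd_nil, mul_one, map_mul (FreeAlgebra.lift ℂ _)] at this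
    rw [wordProd_cons, freeDiff_mul, mul_add, map_add, ← mul_assoc, Algebra.TensorProduct.tmul_mul_tmul,
      mul_one, this, zero_add]
    rw [centredWord_append, centredWord_cons] at hl
    have hx := hl.2.1.1.1
    fin_cases j
    · refine tensorState_mul_freeDiff_mul_eq_zero i hx fun p hp q _ => ?_
      rw [apply_wordProd_mul (by simp [evalState_apply, hφ]) (evalState_wordProd h) hp hl.1 hw
        (fun r hr => hl.2.2 r hr (0, x) (by simp)), zero_mul]
    · rw [freeDiff_eq_zero_of_mem i hx]
      simp

variable [StarOrderedRing M] in
/-- If the families `a` and `b` are free, then the conjugate relations for `a` extend to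
polynomials in `a` and `b`. -/
theorem expect_eq_of_isFree (hcomm : ∀ x y : M, φ (x * y) = φ (y * x)) {ξ : φ.GNS} (i : I)
    (hξ : ξ ∈ l2Closure φ a)
    (hrel : ∀ P, expect φ ξ (FreeAlgebra.lift ℂ a P) = tensorState φ (freeDiff a i P))
    (P : FreeAlgebra ℂ (I ⊕ J)) :
    expect φ ξ (FreeAlgebra.lift ℂ (Sum.elim a b) P) =
      tensorState φ (freeDiff (Sum.elim a b) (Sum.inl i) P) := by
  have hε : evalState φ (Sum.elim a b) 1 = 1 := by simp [evalState_apply, hφ]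
  have hfree := evalState_wordProd h
  have hrel₀ : ∀ x ∈ variableAlgebras I J 0, expect φ ξ (FreeAlgebra.lift ℂ (Sum.elim a b) x) =
      tensorState φ (freeDiff (Sum.elim a b) (Sum.inl i) x) := by
    rintro _ ⟨Q, rfl⟩
    erw [lift_elim_lift_inl, freeDiff_lift_inl]
    exact hrel Q
  -- `ξ` is an `L²`-limit of polynomials in `a`, so orthogonality to `x` may be tested on these.
  have hzero : ∀ x, (∀ y ∈ variableAlgebras I J 0, evalState φ (Sum.elim a b) (y * x) = 0) →
      expect φ ξ (FreeAlgebra.lift ℂ (Sum.elim a b) x) = 0 := by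
    intro x hx
    have hcl : IsClosed {η : φ.GNS | expect φ η (FreeAlgebra.lift ℂ (Sum.elim a b) x) = 0} :=
      isClosed_eq (by unfold expect; fun_prop) continuous_const
    refine closure_minimal ?_ hcl hξ
    rintro _ ⟨y, hy, rfl⟩
    have hy' : y ∈ (FreeAlgebra.lift ℂ a).range := by
      rw [← Algebra.adjoin_range_eq_range_freeAlgebra_lift]
      exact hy
    obtain ⟨Q, rfl⟩ := hy'
    have := hx _ ⟨Q, rfl⟩
    rw [evalState_apply, map_mul] at this
    erw [lift_elim_lift_inl] at this
    exact (expect_toL2 φ hcomm _ _).trans this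
  have hP : P ∈ centredSpan (variableAlgebras I J) (evalState φ (Sum.elim a b)) := by
    rw [centredSpan_eq_top hε iSup_variableAlgebras]
    trivial
  induction hP using Submodule.span_induction with
  | zero => simp [expect, toL2_zero]
  | add x y _ _ hx hy =>
    rw [map_add, map_add, map_add, ← hx, ← hy, ← expectₗ_apply, map_add]
    rfl
  | smul c x _ hx =>
    rw [map_smul, map_smul, map_smul, ← hx, ← expectₗ_apply, map_smul]
    rfl
  | mem x hx =>
    obtain ⟨l, hl, rfl⟩ := hx
    cases l with
    | nil => exact hrel₀ _ (one_mem _)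
    | cons p l =>
      obtain ⟨j, x⟩ := p
      have hl' := hl
      rw [centredWord_cons] at hl'
      obtain ⟨⟨hx, hx'⟩, hl₁, hl₂⟩ := hl'
      by_cases hne : l = []
      · subst hne
        rw [wordProd_cons, wordProd_nil, mul_one]
        fin_cases j
        · exact hrel₀ _ hx
        · rw [freeDiff_eq_zero_of_mem i hx, map_zero]
          refine hzero _ fun y hy => ?_
          simpa using apply_mul_wordProd hε hfree hy hl (by simp) (by simp)
      -- Differentiating a later letter gives zero because a nonempty word precedes it.
      -- Differentiating the first gives right factors `φ (q l)` with `q` a polynomial in `a`, which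
      -- vanish since `l` is nonempty and starts with a `b`-letter.
      · have hD : tensorState φ (freeDiff (Sum.elim a b) (Sum.inl i)
            (wordProd ((j, x) :: l))) = 0 := by
          have h₁ := tensorState_mul_freeDiff_wordProd hφ h i (w := [(j, x)]) (l := l) (by simp) hl
          rw [wordProd_cons, wordProd_nil, mul_one] at h₁
          rw [wordProd_cons, freeDiff_mul, map_add, h₁, zero_add]
          fin_cases j
          · have := tensorState_mul_freeDiff_mul_eq_zero (φ := φ) (a := a) (b := b) i (u := 1)
              (v := wordProd l) hx fun p _ q hq => by
                rw [apply_mul_wordProd hε hfree hq hl₁ hne hl₂, mul_zero]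
            rwa [map_one, ← Algebra.TensorProduct.one_def, one_mul] at this
          · rw [freeDiff_eq_zero_of_mem i hx]
            simp
        rw [hD]
        refine hzero _ fun y hy => ?_
        fin_cases j
        · rw [wordProd_cons, ← mul_assoc]
          exact apply_mul_wordProd hε hfree (mul_mem hy hx) hl₁ hne hl₂
        · exact apply_mul_wordProd hε hfree hy hl (by simp) (by simp)

end

end

/-! ### Matrix units and the equality case -/

section

variable {M : Type*} [CStarAlgebra M] {d : ℕ} {K : Type*}

/-- The matrix units of `M_d(M)` as a family. -/
def matUnits (M : Type*) [CStarAlgebra M] (d : ℕ) :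
    Fin d × Fin d → CStarMatrix (Fin d) (Fin d) M := fun p => matUnit p.1 p.2 1

/-- The homomorphism that maps the variable `x_{pq}` to the polynomial `∑ᵣ e_{rp} X e_{qr}`. -/
def diagonalPoly (d : ℕ) (K : Type*) :
    FreeAlgebra ℂ ((Fin d × Fin d) × K) →ₐ[ℂ] FreeAlgebra ℂ (K ⊕ (Fin d × Fin d)) :=
  FreeAlgebra.lift ℂ fun p => ∑ r, FreeAlgebra.ι ℂ (Sum.inr (r, p.1.1)) *
    FreeAlgebra.ι ℂ (Sum.inl p.2) * FreeAlgebra.ι ℂ (Sum.inr (p.1.2, r))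

theorem sum_matrix_apply {ι : Type*} (s : Finset ι) (X : ι → CStarMatrix (Fin d) (Fin d) M)
    (i j : Fin d) : (∑ k ∈ s, X k) i j = ∑ k ∈ s, X k i j :=
  map_sum (entryₗ i j) X s

theorem range_matUnits_subset : Set.range (matUnits M d) ⊆ scalarMatrices M d := by
  rintro _ ⟨p, rfl⟩ i j
  refine ⟨if p.1 = i ∧ p.2 = j then 1 else 0, ?_⟩
  rw [matUnits, matUnit_apply]
  split_ifs <;> simp

theorem lift_diagonalPoly_apply (A : K → CStarMatrix (Fin d) (Fin d) M)
    (P : FreeAlgebra ℂ ((Fin d × Fin d) × K)) (r s : Fin d) :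
    FreeAlgebra.lift ℂ (Sum.elim A (matUnits M d)) (diagonalPoly d K P) r s =
      if r = s then FreeAlgebra.lift ℂ (entries A) P else 0 := by
  induction P using FreeAlgebra.induction generalizing r s with
  | grade0 c =>
    rw [AlgHom.commutes, AlgHom.commutes, AlgHom.commutes]
    exact CStarMatrix.algebraMap_apply
  | grade1 p =>
    simp only [diagonalPoly, FreeAlgebra.lift_ι_apply, map_sum, map_mul, Sum.elim_inl,
      Sum.elim_inr, matUnits, sum_matrix_apply, mul_matUnit_apply, matUnit_mul_apply, entries,
      one_mul, mul_one]
    by_cases h : r = s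
    · simp [h]
    · simp [h, Ne.symm h]
  | mul P Q hP hQ =>
    rw [map_mul, map_mul, map_mul, CStarMatrix.mul_apply]
    simp [hP, hQ]
  | add P Q hP hQ =>
    rw [map_add, map_add, map_add, CStarMatrix.add_apply, hP, hQ]
    split_ifs <;> simp

variable [PartialOrder M] [StarOrderedRing M]

variable [DecidableEq K]

/-- On a variable, `∂ (∑ₜ e_{tp} X e_{qt}) = ∑ₜ e_{tp} ⊗ e_{qt}`, of which the compression keeps `t
= r = s`. Products follow because the values of `diagonalPoly` are scalar multiples of the identity
over `M`. -/
theorem compress_freeDiff_diagonalPoly (A : K → CStarMatrix (Fin d) (Fin d) M)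
    (P : FreeAlgebra ℂ ((Fin d × Fin d) × K)) (r u v s : Fin d) (k : K) :
    compress r u v s
        (freeDiff (Sum.elim A (matUnits M d)) (Sum.inl k) (diagonalPoly d K P)) =
      if r = s then freeDiff (entries A) ((u, v), k) P else 0 := by
  induction P using FreeAlgebra.induction generalizing r u v s with
  | grade0 c =>
    rw [AlgHom.commutes]
    simp [freeDiff]
  | grade1 p =>
    obtain ⟨⟨p, q⟩, l⟩ := p
    have h : freeDiff (Sum.elim A (matUnits M d)) (Sum.inl k)
        (diagonalPoly d K (FreeAlgebra.ι ℂ ((p, q), l))) =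
        if k = l then ∑ t, matUnit t p (1 : M) ⊗ₜ[ℂ] matUnit q t (1 : M) else 0 := by
      simp only [diagonalPoly, FreeAlgebra.lift_ι_apply, map_sum, freeDiff, der_mul, der_ι]
      by_cases hk : k = l <;> simp [hk, matUnits]
    rw [h]
    by_cases hk : k = l
    · simp only [hk, if_true, map_sum, compress_tmul, matUnit_apply, freeDiff, der_ι,
        Prod.mk.injEq]
      by_cases hu : p = u
      · by_cases hv : q = v
        · by_cases hr : r = s
          · rw [Finset.sum_eq_single r]
            · simp [hu, hv, hr, Algebra.TensorProduct.one_def]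
            · intro t _ ht
              simp [ht]
            · simp
          · rw [if_neg hr]
            refine Finset.sum_eq_zero fun t _ => ?_
            by_cases ht : t = r
            · simp [ht, hr]
            · simp [ht]
        · simp [hv, Ne.symm hv]
      · simp [hu, Ne.symm hu]
    · simp [hk, freeDiff]
  | mul P Q hP hQ =>
    rw [map_mul, freeDiff_mul, freeDiff_mul, map_add, compress_left_mul, compress_mul_right]
    simp only [hP, hQ, lift_diagonalPoly_apply]
    by_cases hr : r = s
    · simp [hr, TensorProduct.ite_tmul, TensorProduct.tmul_ite]
    · simp [hr, TensorProduct.ite_tmul, TensorProduct.tmul_ite]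
  | add P Q hP hQ =>
    rw [map_add, map_add, map_add, map_add, hP, hQ]
    split_ifs <;> simp

variable {φ : M →ₚ[ℂ] ℂ}

theorem tensorState_mul_matUnit (hd : 0 < d) (p q : Fin d)
    (T : CStarMatrix (Fin d) (Fin d) M ⊗[ℂ] CStarMatrix (Fin d) (Fin d) M) :
    (d : ℂ) ^ 2 * tensorState (matrixState φ d) (T * 1 ⊗ₜ matUnit p q (1 : M)) =
      ∑ j, tensorState φ (compress j j q p T) := by
  have hd' : (d : ℂ) ≠ 0 := by exact_mod_cast hd.ne'
  have h : ∀ i j, compress j j i i (T * 1 ⊗ₜ matUnit p q (1 : M)) =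
      if q = i then compress j j q p T else 0 := by
    intro i j
    rw [compress_mul_right, Finset.sum_eq_single p]
    · by_cases hq : q = i
      · simp [matUnit_apply, hq, ← Algebra.TensorProduct.one_def]
      · simp [matUnit_apply, hq]
    · intro t _ ht
      simp [matUnit_apply, Ne.symm ht]
    · simp
  rw [tensorState_matrixState, Finset.sum_eq_single q]
  · simp only [h, if_true, ← Finset.mul_sum]
    field_simp
  · intro i _ hi
    simp [h, Ne.symm hi]
  · simp

theorem expect_matUnit (ξ : (matrixState φ d).GNS) (p q : Fin d) (x : M) :
    expect (matrixState φ d) ξ (matUnit p q x) = (d : ℂ)⁻¹ * expect φ (entryL2 φ q p ξ) x := by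
  rw [expect_matrix, Finset.sum_eq_single q, Finset.sum_eq_single p]
  · simp [matUnit_apply]
  · intro j _ hj
    simp [matUnit_apply, Ne.symm hj, expect, toL2_zero]
  · simp
  · intro i _ hi
    simp [matUnit_apply, Ne.symm hi, expect, toL2_zero]
  · simp

omit [DecidableEq K] in
theorem entryL2_mem_l2Closure {A : K → CStarMatrix (Fin d) (Fin d) M}
    {ξ : (matrixState φ d).GNS} (hξ : ξ ∈ l2Closure (matrixState φ d) A) (i j : Fin d) :
    entryL2 φ i j ξ ∈ l2Closure φ (entries A) := by
  have hcl : IsClosed {η | entryL2 φ i j η ∈ l2Closure φ (entries A)} :=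
    (Submodule.isClosed_topologicalClosure _).preimage (entryL2 φ i j).continuous
  refine closure_minimal ?_ hcl hξ
  rintro _ ⟨X, hX, rfl⟩
  have hX' : X ∈ (FreeAlgebra.lift ℂ A).range := by
    rw [← Algebra.adjoin_range_eq_range_freeAlgebra_lift]
    exact hX
  obtain ⟨P, rfl⟩ := hX'
  change entryL2 φ i j (toL2 (matrixState φ d) (FreeAlgebra.lift ℂ A P)) ∈ l2Closure φ (entries A)
  rw [entryL2_toL2, ← lift_entries_genericMatrix]
  exact toL2_mem_l2Closure φ _ (lift_mem_adjoin _ _)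

theorem IsFree.mono {N ι : Type*} [CStarAlgebra N] [PartialOrder N] {ψ : N →ₚ[ℂ] ℂ}
    {S T : ι → Set N} (h : IsFree ψ T) (hST : ∀ i, S i ⊆ T i) : IsFree ψ S :=
  fun n i x hx => h n i x fun k => Algebra.adjoin_mono (hST _) (hx k)

/-- If a family of matrices is free from the scalar matrices, then a conjugate system for it yields
a conjugate system for the entries. -/
theorem isConjugateSystem_entries (h1 : φ 1 = 1) (hcomm : ∀ x y : M, φ (x * y) = φ (y * x))
    (hd : 0 < d) {A : K → CStarMatrix (Fin d) (Fin d) M}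
    (hfree : IsFree (matrixState φ d) ![Set.range A, scalarMatrices M d])
    {ξ : K → (matrixState φ d).GNS} (hξ : IsConjugateSystem (matrixState φ d) A ⊥ ξ) :
    IsConjugateSystem φ (entries A) ⊥ fun p => (d : ℂ) • entryL2 φ p.1.2 p.1.1 (ξ p.2) := by
  have hd' : (d : ℂ) ≠ 0 := by exact_mod_cast hd.ne'
  have hfree' : IsFree (matrixState φ d) ![Set.range A, Set.range (matUnits M d)] :=
    hfree.mono fun i => by
      fin_cases i
      · exact subset_rfl
      · exact range_matUnits_subset
  rw [isConjugateSystem_bot_iff] at hξ ⊢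
  refine ⟨?_, fun p => Submodule.smul_mem _ _ (entryL2_mem_l2Closure (hξ.2 _) _ _)⟩
  rintro ⟨⟨p, q⟩, k⟩ P
  -- Placing `P(a)` at position `(p, q)` gives a test element that isolates one entry of `ξ k`.
  have hev : matUnit p q (FreeAlgebra.lift ℂ (entries A) P) =
      FreeAlgebra.lift ℂ (Sum.elim A (matUnits M d))
        (diagonalPoly d K P * FreeAlgebra.ι ℂ (Sum.inr (p, q))) := by
    ext i j
    rw [map_mul, FreeAlgebra.lift_ι_apply, Sum.elim_inr, matUnits, mul_matUnit_apply,
      lift_diagonalPoly_apply, matUnit_apply, mul_one]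
    by_cases hi : p = i <;> by_cases hj : q = j <;> simp [hi, hj, eq_comm]
  have hD : freeDiff (Sum.elim A (matUnits M d)) (Sum.inl k)
      (diagonalPoly d K P * FreeAlgebra.ι ℂ (Sum.inr (p, q))) =
      freeDiff (Sum.elim A (matUnits M d)) (Sum.inl k) (diagonalPoly d K P) *
        1 ⊗ₜ matUnit p q (1 : M) := by
    rw [freeDiff_mul]
    simp [freeDiff, matUnits]
  have hexp := expect_eq_of_isFree (matrixState_one φ h1 hd) hfree' (matrixState_mul_comm φ hcomm)
    k (hξ.2 k) (hξ.1 k) (diagonalPoly d K P * FreeAlgebra.ι ℂ (Sum.inr (p, q)))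
  rw [← hev, hD, expect_matUnit] at hexp
  have := tensorState_mul_matUnit (φ := φ) hd p q
    (freeDiff (Sum.elim A (matUnits M d)) (Sum.inl k) (diagonalPoly d K P))
  rw [← hexp] at this
  simp only [compress_freeDiff_diagonalPoly] at this
  -- Only `j = p` survives. The remaining factors `d²` and `d⁻¹` explain the scalar `d` in the
  -- conjugate system.
  rw [Finset.sum_eq_single p (by intro j _ hj; simp [hj]) (by simp), if_pos rfl] at this
  rw [expect_smul, ← this]
  field_simp

theorem fisher_entries_eq [Fintype K] (h1 : φ 1 = 1) (hcomm : ∀ x y : M, φ (x * y) = φ (y * x))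
    (hd : 0 < d) {A : K → CStarMatrix (Fin d) (Fin d) M}
    (hA : ∀ i, ∃ j, star (A i) = A j) (hA' : ∀ i, ∃ j, star (entries A i) = entries A j)
    (hfree : IsFree (matrixState φ d) ![Set.range A, scalarMatrices M d]) :
    fisher φ (entries A) = (d : ℝ≥0∞) ^ 3 * fisher (matrixState φ d) A := by
  by_cases h : ∃ ξ, IsConjugateSystem (matrixState φ d) A ⊥ ξ
  · obtain ⟨ξ, hξ⟩ := h
    rw [fisher_eq_sum hA hξ,
      fisher_eq_sum hA' (isConjugateSystem_entries h1 hcomm hd hfree hξ),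
      Finset.mul_sum, Fintype.sum_prod_type_right]
    refine Finset.sum_congr rfl fun k _ => ?_
    rw [norm_sq_matrix, ← ENNReal.ofReal_sum_of_nonneg fun _ _ => by positivity,
      ← ENNReal.ofReal_natCast, ← ENNReal.ofReal_pow (by positivity),
      ← ENNReal.ofReal_mul (by positivity), Fintype.sum_prod_type_right]
    have : (d : ℝ) ≠ 0 := by exact_mod_cast hd.ne'
    simp only [norm_smul, mul_pow, Complex.norm_natCast, ← Finset.mul_sum]
    field_simp
  -- Without a conjugate system for `A` the general inequality already forces both sides to be
  -- infinite, as `d ≠ 0`.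
  · refine le_antisymm ?_ (fisher_matrix_le hd hA hA')
    rw [fisher_eq_top h, ENNReal.mul_top (by positivity)]
    exact le_top

end

end

end FreeProb

/-! ### The theorem for `{X, X*}` and for selfadjoint `Y` -/

open FreeProb
theorem theorem1p2 {A : Type*} [CStarAlgebra A] [WStarAlgebra A] [PartialOrder A]
    [StarOrderedRing A] (φ : A →ₚ[ℂ] ℂ) (hφ : IsFaithfulNormalTracialState φ)
    (d : ℕ) (hd : 0 < d) :
    (∀ X : CStarMatrix (Fin d) (Fin d) A,
      (d : ℝ≥0∞) ^ 3 * fisher (matrixState φ d) ![X, star X] ≤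
          fisher φ (fun p : (Fin d × Fin d) × Fin 2 =>
            ![X p.1.1 p.1.2, star (X p.1.1 p.1.2)] p.2) ∧
      (IsFree (matrixState φ d) ![{X, star X}, scalarMatrices A d] →
        fisher φ (fun p : (Fin d × Fin d) × Fin 2 =>
            ![X p.1.1 p.1.2, star (X p.1.1 p.1.2)] p.2) =
          (d : ℝ≥0∞) ^ 3 * fisher (matrixState φ d) ![X, star X])) ∧
    (∀ Y : CStarMatrix (Fin d) (Fin d) A, IsSelfAdjoint Y →
      (d : ℝ≥0∞) ^ 3 * fisher (matrixState φ d) (fun _ : Fin 1 => Y) ≤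
          fisher φ (fun p : Fin d × Fin d => Y p.1 p.2) ∧
      (IsFree (matrixState φ d) ![{Y}, scalarMatrices A d] →
        fisher φ (fun p : Fin d × Fin d => Y p.1 p.2) =
          (d : ℝ≥0∞) ^ 3 * fisher (matrixState φ d) (fun _ : Fin 1 => Y))) := by
  refine ⟨fun X => ?_, fun Y hY => ?_⟩
  · have hA : ∀ i, ∃ j, star (![X, star X] i) = ![X, star X] j := by
      intro i
      fin_cases i
      · exact ⟨1, rfl⟩
      · exact ⟨0, star_star X⟩
    have hA' : ∀ i, ∃ j, star (entries ![X, star X] i) = entries ![X, star X] j := by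
      rintro ⟨⟨i, j⟩, k⟩
      fin_cases k
      · exact ⟨((j, i), 1), rfl⟩
      · exact ⟨((j, i), 0), star_star (X j i)⟩
    -- The `(i, j)` entry of `star X` is the adjoint of the `(j, i)` entry of `X`, so the two
    -- families differ by a swap of indices on the adjoint half.
    have he : Function.Involutive fun p : (Fin d × Fin d) × Fin 2 =>
        if p.2 = 0 then p else (p.1.swap, p.2) := by
      rintro ⟨p, k⟩
      fin_cases k <;> simp
    have hcomp : (fun p : (Fin d × Fin d) × Fin 2 =>
        ![X p.1.1 p.1.2, star (X p.1.1 p.1.2)] p.2) = entries ![X, star X] ∘ he.toPerm := by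
      funext ⟨p, k⟩
      fin_cases k <;> rfl
    have hrange : Set.range ![X, star X] = {X, star X} := by
      simp [Set.pair_comm]
    rw [hcomp, fisher_comp_equiv φ hA', ← hrange]
    exact ⟨fisher_matrix_le hd hA hA',
      fisher_entries_eq hφ.map_one hφ.map_mul_comm hd hA hA'⟩
  · have hA : ∀ i : Fin 1, ∃ j : Fin 1, star ((fun _ : Fin 1 => Y) i) = (fun _ : Fin 1 => Y) j :=
      fun _ => ⟨0, hY⟩
    have hA' : ∀ i, ∃ j, star (entries (fun _ : Fin 1 => Y) i) =
        entries (fun _ : Fin 1 => Y) j := by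
      rintro ⟨⟨i, j⟩, k⟩
      exact ⟨((j, i), k), congrFun (congrFun hY j) i⟩
    have hcomp : (fun p : Fin d × Fin d => Y p.1 p.2) =
        entries (fun _ : Fin 1 => Y) ∘ (Equiv.prodUnique _ (Fin 1)).symm := rfl
    have hrange : Set.range (fun _ : Fin 1 => Y) = {Y} := Set.range_const
    rw [hcomp, fisher_comp_equiv φ hA', ← hrange]
    exact ⟨fisher_matrix_le hd hA hA',
      fisher_entries_eq hφ.map_one hφ.map_mul_comm hd hA hA'⟩
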